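/- A mosaic tile is a unit square of one of the following eleven kinds, where $L,R,B,T$ are the midpoints of its left, right, bottom and top sides: type I (blank); type IIa, IIb, IIc, IId (one arc joining $L,B$; $B,R$; $R,T$; $T,L$, respectively); type IIIa, IIIb (one segment joining $L,R$; $B,T$); type IVa (two disjoint arcs joining $L,B$ and $R,T$) and type IVb (two disjoint arcs joining $B,R$ and $T,L$); type Va, Vb (the segments $LR$ and $BT$ crossing each other, with either one passing over the other). A further square, type 0, carries only a dot and is not a mosaic tile. An $n$-mosaic is an $n\times n$ matrix of mosaic tiles. It is a knot mosaic for a knot $K\subset\mathbb{R}^3$ if the strands on adjacent tiles match along the common side, no strand ends on the boundary of the board, and the resulting diagram is a diagram of a one-component link that is equivalent to $K$ (by isotopy, or what is the same for polygonal knots, by triangle moves). Let $S$ be the set of those $(n-2)^2$ positions that are not in the first or last row or column. A dual $D$ of a mosaic places a tile at each position of $S$: V is replaced by I, IV by 0, IIIa and IIIb by each other, IIa and IIc by each other, IIb and IId by each other, and I by IVa or IVb (either choice is allowed at each position). Let $|D|$ be the number of non-blank tiles of $D$, let $D'$ be the set of the non-blank tiles of $D$ that are not of type 0, and let $D''$ be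 the set of tiles of type IV in $D$. Put $T(D)=(|D|,|D'|,|D''|)$, ordered lexicographically; it does not depend on the choice of the dual. Say that a dual $D$ of a knot $n$-mosaic for $K$ has minimal triple if $T(D)\le T(E)$ for every dual $E$ of every knot $n$-mosaic for $K$. **Corollary.** Let $n=2k$ be even and let $K$ be a knot. (1) If $M_n$ is a knot $n$-mosaic for $K$, $D$ is a dual of $M_n$ with minimal triple, and $|D|\le n-4$, then $|D'|=0$; thus every non-blank tile of $D$ is of type 0. (2) Consequently, if $K$ has a knot $n$-mosaic with a dual $D$ satisfying $|D|\le n-4$, then $K$ has a knot $n$-mosaic with a dual $D_0$ that has minimal triple, satisfies $|D_0|\le n-4$, and has no non-blank tiles other than tiles of type 0. -/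

import Mathlib

namespace KnotMosaic

/-- The four sides of a square tile. -/
inductive Side
  | left
  | right
  | bottom
  | top
  deriving DecidableEq

/-- The tiles. `t0` (a square with a dot) only occurs in duals; the other eleven are the
mosaic tiles. What each tile looks like is given by `Tile.strands`. -/
inductive Tile
  | t0
  | t1
  | t2a
  | t2b
  | t2c
  | t2d
  | t3a
  | t3b
  | t4a
  | t4b
  | t5a
  | t5b
  deriving DecidableEq

/-- The strands drawn on a tile. A strand `(s, s', h)` joins the midpoints of the sides `s` and
`s'`, and its own midpoint lies at height `h`. All heights are `0`, except for the over-strand of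
a crossing tile. -/
def Tile.strands : Tile → List (Side × Side × ℕ)
  | .t0 => []
  | .t1 => []
  | .t2a => [(.left, .bottom, 0)]
  | .t2b => [(.bottom, .right, 0)]
  | .t2c => [(.right, .top, 0)]
  | .t2d => [(.top, .left, 0)]
  | .t3a => [(.left, .right, 0)]
  | .t3b => [(.bottom, .top, 0)]
  | .t4a => [(.left, .bottom, 0), (.right, .top, 0)]
  | .t4b => [(.bottom, .right, 0), (.top, .left, 0)]
  | .t5a => [(.left, .right, 1), (.bottom, .top, 0)]
  | .t5b => [(.left, .right, 0), (.bottom, .top, 1)]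

/-- The tile `t` has a strand ending on its side `s`. -/
def Tile.Meets (t : Tile) (s : Side) : Prop :=
  ∃ c ∈ t.strands, c.1 = s ∨ c.2.1 = s

/-- An `n`-mosaic: an `n × n` matrix of mosaic tiles. The first index is the row, counted from
the bottom, and the second index is the column, counted from the left (both from `0`). -/
structure Mosaic (n : ℕ) where
  /-- the tile in a given row and column -/
  tile : Fin n → Fin n → Tile
  /-- the dotted tile is not a mosaic tile -/
  tile_ne : ∀ i j, tile i j ≠ Tile.t0

/-- Suitable connectedness: the strands on adjacent tiles match along the common side, and no
strand ends on the boundary of the board. -/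
structure Mosaic.SuitablyConnected {n : ℕ} (M : Mosaic n) : Prop where
  horizontal : ∀ i j j' : Fin n, (j' : ℕ) = j + 1 →
    ((M.tile i j).Meets .right ↔ (M.tile i j').Meets .left)
  vertical : ∀ i i' j : Fin n, (i' : ℕ) = i + 1 →
    ((M.tile i j).Meets .top ↔ (M.tile i' j).Meets .bottom)
  left_end : ∀ i j : Fin n, (j : ℕ) = 0 → ¬ (M.tile i j).Meets .left
  right_end : ∀ i j : Fin n, (j : ℕ) + 1 = n → ¬ (M.tile i j).Meets .right
  bottom_end : ∀ i j : Fin n, (i : ℕ) = 0 → ¬ (M.tile i j).Meets .bottom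
  top_end : ∀ i j : Fin n, (i : ℕ) + 1 = n → ¬ (M.tile i j).Meets .top

/-- The midpoint of a side of the tile in row `i` and column `j`. The tile occupies the square
`[2j, 2j+2] × [2i, 2i+2]` in the plane of height `0` in `ℝ³`. -/
def sidePoint (i j : ℕ) : Side → (Fin 3 → ℝ)
  | .left => ![2 * (j : ℝ), 2 * (i : ℝ) + 1, 0]
  | .right => ![2 * (j : ℝ) + 2, 2 * (i : ℝ) + 1, 0]
  | .bottom => ![2 * (j : ℝ) + 1, 2 * (i : ℝ), 0]
  | .top => ![2 * (j : ℝ) + 1, 2 * (i : ℝ) + 2, 0]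

/-- The middle point of a strand of the tile in row `i` and column `j`. -/
noncomputable def strandMid (i j : ℕ) (c : Side × Side × ℕ) : Fin 3 → ℝ :=
  midpoint ℝ (sidePoint i j c.1) (sidePoint i j c.2.1) + ![0, 0, (c.2.2 : ℝ)]

/-- A strand as a polygonal arc in `ℝ³`: two segments meeting in the middle point (together a
single segment if the height is `0`). -/
noncomputable def strandSet (i j : ℕ) (c : Side × Side × ℕ) : Set (Fin 3 → ℝ) :=
  segment ℝ (sidePoint i j c.1) (strandMid i j c) ∪
    segment ℝ (strandMid i j c) (sidePoint i j c.2.1)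

/-- The polygonal subset of `ℝ³` whose projection is drawn on the mosaic. For a suitably
connected mosaic it is a disjoint union of simple closed polygons, that is, a link. -/
noncomputable def Mosaic.realization {n : ℕ} (M : Mosaic n) : Set (Fin 3 → ℝ) :=
  ⋃ (i : Fin n) (j : Fin n), ⋃ c ∈ (M.tile i j).strands, strandSet i j c

/-- A knot mosaic: a suitably connected mosaic representing a link with exactly one component. -/
def Mosaic.IsKnotMosaic {n : ℕ} (M : Mosaic n) : Prop :=
  M.SuitablyConnected ∧ IsConnected M.realization

/-- A triangle move (`Δ`-move) on a polygonal knot: if the knot meets a nondegenerate triangle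
`ABC` exactly in its side `AB`, replace this side by the other two. -/
def TriangleMove (K K' : Set (Fin 3 → ℝ)) : Prop :=
  ∃ A B C : Fin 3 → ℝ, AffineIndependent ℝ ![A, B, C] ∧
    K ∩ convexHull ℝ {A, B, C} = segment ℝ A B ∧
    K' = (K \ segment ℝ A B) ∪ (segment ℝ A C ∪ segment ℝ C B)

/-- The usual equivalence of polygonal knots in `ℝ³`: finitely many triangle moves and inverse
triangle moves (for polygonal knots this is the same as ambient isotopy). -/
def KnotEquiv (K K' : Set (Fin 3 → ℝ)) : Prop :=
  Relation.EqvGen TriangleMove K K'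

/-- `M` is a knot mosaic for the knot `K`. -/
def Mosaic.IsKnotMosaicFor {n : ℕ} (M : Mosaic n) (K : Set (Fin 3 → ℝ)) : Prop :=
  M.IsKnotMosaic ∧ KnotEquiv M.realization K

/-- The positions (row, column) of the interior `S` of an `n × n` board, i.e. those that are not
in the first or last row or column. -/
abbrev Interior (n : ℕ) : Type :=
  {p : Fin n × Fin n // (0 < (p.1 : ℕ) ∧ (p.1 : ℕ) + 1 < n) ∧ 0 < (p.2 : ℕ) ∧ (p.2 : ℕ) + 1 < n}

/-- `IsDualTile R T`: in a dual, the mosaic tile `R` may be replaced by `T`. There is exactly one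
such `T`, except that a blank tile may be replaced by either tile of type IV. -/
def IsDualTile : Tile → Tile → Prop
  | .t0, _ => False
  | .t1, T => T = .t4a ∨ T = .t4b
  | .t2a, T => T = .t2c
  | .t2b, T => T = .t2d
  | .t2c, T => T = .t2a
  | .t2d, T => T = .t2b
  | .t3a, T => T = .t3b
  | .t3b, T => T = .t3a
  | .t4a, T => T = .t0
  | .t4b, T => T = .t0
  | .t5a, T => T = .t1
  | .t5b, T => T = .t1

/-- `D` is a dual of the mosaic `M`. -/
def IsDual {n : ℕ} (M : Mosaic n) (D : Interior n → Tile) : Prop :=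
  ∀ p, IsDualTile (M.tile p.1.1 p.1.2) (D p)

/-- `|D|`: the number of tiles of `D`, not counting the blank ones. -/
def dualCard {n : ℕ} (D : Interior n → Tile) : ℕ :=
  (Finset.univ.filter fun p => D p ≠ .t1).card

/-- `|D'|`, where `D'` is obtained from `D` by leaving out the tiles of type 0. -/
def dualCard' {n : ℕ} (D : Interior n → Tile) : ℕ :=
  (Finset.univ.filter fun p => D p ≠ .t1 ∧ D p ≠ .t0).card

/-- `|D''|`, where `D''` consists of the tiles of type IV in `D`. -/
def dualCard'' {n : ℕ} (D : Interior n → Tile) : ℕ :=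
  (Finset.univ.filter fun p => D p = .t4a ∨ D p = .t4b).card

/-- The triple `T = (|D|, |D'|, |D''|)`, with the lexicographic order. -/
def dualTriple {n : ℕ} (D : Interior n → Tile) : ℕ ×ₗ (ℕ ×ₗ ℕ) :=
  toLex (dualCard D, toLex (dualCard' D, dualCard'' D))

/-- `M` is a knot mosaic for `K` with dual `D`, and the triple of `D` is minimal among the triples
of the duals of all knot mosaics for `K` of the same size. -/
def HasMinimalTriple {n : ℕ} (K : Set (Fin 3 → ℝ)) (M : Mosaic n) (D : Interior n → Tile) :
    Prop :=
  M.IsKnotMosaicFor K ∧ IsDual M D ∧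
    ∀ (M' : Mosaic n) (D' : Interior n → Tile), M'.IsKnotMosaicFor K → IsDual M' D' →
      dualTriple D ≤ dualTriple D'

end KnotMosaic

/-! Write n = N + 2 with N = 2q. By hypothesis at most N - 2 interior tiles are not crossings. The
proof counts edges in a graph and then makes one local move.

The vertices of the graph are the N interior rows and the N interior columns. A strand goes straight
through a crossing, so it stays in its row or column. As the mosaic has one component, the places
where strands change lines must connect the graph. A non-crossing tile joins its row to its column,
a corner of the board joins an extreme row to an extreme column, and a strand along the edge of the
board joins two adjacent lines. The last kind matters only at a full cut, one that is crossed in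
every interior line as well: where an interior line misses the cut, the two tiles beside it are
non-crossings and already give the connection. Two consecutive full cuts would leave the line
between them without strands along it, which forces N non-crossings. Hence there are at most q full
cuts in each direction, and at most q - 1 if some crossed corner exists.

A connected graph on 2N vertices has at least 2N - 1 edges, and the four corner links form a cycle,
so only three of them count. With at most N - 2 non-crossings every estimate must be sharp
(`SideGrid.exists_crossedCorners`): the links form a spanning tree, and the full cuts are the even
ones (`SideGrid.H_even`).

So the interior splits into 2 × 2 blocks whose outer sides are all met, except possibly along the
edge of the board. A tree contains no 4-cycle, so no block consists of four non-crossings. Parity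
(`block_sides`) then leaves two cases. Either every side of every tile of the block is met, or a
strand runs straight past the block along the edge of the board (`SideGrid.HasEdgeArc`). In the
second case pushing this strand inwards is a triangle move (`Mosaic.exists_push`) that turns two
tiles of type II into type IV. This keeps |D| and lowers |D'|, against minimality. So every interior
tile is of type IV or V, and its dual is of type 0 or blank. Part (2) follows because the
lexicographic order is a well-order. -/

/-- A finite graph whose locally constant functions with values in `ZMod 2` are constant on a set
of vertices has at least as many edges as that set has vertices, minus one. -/
theorem card_le_card_edges_add_one {α : Type*} [DecidableEq α] (S : Finset α)
    (E : Finset (α × α))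
    (h : ∀ f : α → ZMod 2, (∀ e ∈ E, f e.1 = f e.2) → ∀ u ∈ S, ∀ v ∈ S, f u = f v) :
    S.card ≤ E.card + 1 := by
  classical
  -- Edges may have endpoints outside `S`, so functions on `S` are extended by zero.
  let ext : (S → ZMod 2) →ₗ[ZMod 2] (α → ZMod 2) :=
    { toFun := fun f a => if ha : a ∈ S then f ⟨a, ha⟩ else 0
      map_add' := by
        intro f g; funext a; by_cases ha : a ∈ S <;> simp [ha]
      map_smul' := by
        intro c f; funext a; by_cases ha : a ∈ S <;> simp [ha] }
  -- The coboundary map. Its kernel consists of constants, so rank-nullity bounds the number of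
  -- edges from below.
  let T : (S → ZMod 2) →ₗ[ZMod 2] (E → ZMod 2) :=
    { toFun := fun f e => ext f e.1.1 - ext f e.1.2
      map_add' := by
        intro f g; funext e; simp only [map_add, Pi.add_apply]; ring
      map_smul' := by
        intro c f; funext e; simp [mul_sub] }
  have hker : T.ker ≤ Submodule.span (ZMod 2) {fun _ => (1 : ZMod 2)} := by
    intro f hf
    have hf' : ∀ e ∈ E, ext f e.1 = ext f e.2 := by
      intro e he
      have := congrFun (LinearMap.mem_ker.1 hf) ⟨e, he⟩
      exact sub_eq_zero.1 this
    have hc := h _ hf'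
    rw [Submodule.mem_span_singleton]
    by_cases hS : S.Nonempty
    · obtain ⟨s, hs⟩ := hS
      refine ⟨f ⟨s, hs⟩, ?_⟩
      funext a
      have := hc s hs a.1 a.2
      simpa [ext, hs] using this
    · refine ⟨0, ?_⟩
      funext a
      exact absurd ⟨a.1, a.2⟩ hS
  have h1 := LinearMap.finrank_range_add_finrank_ker T
  have h2 : Module.finrank (ZMod 2) T.range ≤ E.card := by
    have := Submodule.finrank_le T.range
    simpa using this
  have h3 : Module.finrank (ZMod 2) T.ker ≤ 1 :=
    (Submodule.finrank_mono hker).trans (by simpa using finrank_span_le_card (R := ZMod 2) {fun _ : S => (1 : ZMod 2)})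
  simp only [Module.finrank_fintype_fun_eq_card, Fintype.card_coe] at h1
  omega

/-! ### Side patterns, parity and full cuts -/

/-- The sides met by the strands of a one-component mosaic on a board with `N + 2` rows and columns,
together with the set `D` of the interior tiles that are not crossings. `H i j` and `V i j` say
whether the left and the bottom side of the tile in row `i` and column `j` are met. -/
structure SideGrid (N : ℕ) where
  H : ℕ → ℕ → Bool
  V : ℕ → ℕ → Bool
  D : Finset (ℕ × ℕ)
  even_tile : ∀ i j, i ≤ N + 1 → j ≤ N + 1 →
    (H i j ^^ H i (j + 1) ^^ V i j ^^ V (i + 1) j) = false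
  H_zero : ∀ i, H i 0 = false
  H_end : ∀ i, H i (N + 2) = false
  V_zero : ∀ j, V 0 j = false
  V_end : ∀ j, V (N + 2) j = false
  crossing : ∀ i j, 1 ≤ i → i ≤ N → 1 ≤ j → j ≤ N → (i, j) ∉ D →
    H i j = true ∧ H i (j + 1) = true ∧ V i j = true ∧ V (i + 1) j = true
  connected : ∀ gH gV : ℕ → ℕ → ZMod 2,
    (∀ i j, 1 ≤ i → i ≤ N → 1 ≤ j → j ≤ N → (i, j) ∉ D →
      gH i j = gH i (j + 1) ∧ gV i j = gV (i + 1) j) →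
    (∀ i j, i ≤ N + 1 → j ≤ N + 1 → ¬ (1 ≤ i ∧ i ≤ N ∧ 1 ≤ j ∧ j ≤ N ∧ (i, j) ∉ D) →
      ∃ a, (H i j = true → gH i j = a) ∧ (H i (j + 1) = true → gH i (j + 1) = a) ∧
        (V i j = true → gV i j = a) ∧ (V (i + 1) j = true → gV (i + 1) j = a)) →
    ∃ a, ∀ i j, i ≤ N + 1 → j ≤ N + 1 →
      (H i j = true → gH i j = a) ∧ (V i j = true → gV i j = a)

namespace SideGrid

variable {N : ℕ} (G : SideGrid N)

/-- Interchange rows and columns. -/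
def transpose : SideGrid N where
  H i j := G.V j i
  V i j := G.H j i
  D := G.D.map (Equiv.prodComm ℕ ℕ).toEmbedding
  even_tile i j hi hj := by
    have := G.even_tile j i hj hi
    revert this
    cases G.H j i <;> cases G.H j (i + 1) <;> cases G.V j i <;> cases G.V (j + 1) i <;> simp
  H_zero i := G.V_zero i
  H_end i := G.V_end i
  V_zero j := G.H_zero j
  V_end j := G.H_end j
  crossing i j hi hi' hj hj' h := by
    have := G.crossing j i hj hj' hi hi' (by simpa using h)
    tauto
  connected gH gV h1 h2 := by
    obtain ⟨a, ha⟩ := G.connected (fun i j => gV j i) (fun i j => gH j i)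
      (fun i j hi hi' hj hj' h => (h1 j i hj hj' hi hi' (by simpa using h)).symm)
      (fun i j hi hj h => by
        obtain ⟨a, ha⟩ := h2 j i hj hi (by simp at h ⊢; tauto)
        exact ⟨a, by tauto⟩)
    exact ⟨a, fun i j hi hj => (ha j i hj hi).symm⟩

theorem mem_transpose_D {i j : ℕ} : (i, j) ∈ G.transpose.D ↔ (j, i) ∈ G.D := by
  simp [transpose]

theorem card_transpose_D : G.transpose.D.card = G.D.card := by
  simp [transpose]

/-- A vertical line is crossed an even number of times. -/
theorem sum_H_eq_zero (j : ℕ) (hj : j ≤ N + 2) :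
    ∑ i ∈ Finset.range (N + 2), (if G.H i j = true then (1 : ZMod 2) else 0) = 0 := by
  induction j with
  | zero => simp [G.H_zero]
  | succ j ih =>
    have h0 := ih (by omega)
    -- The sums differ only in the terms at `0` and `N + 2`, which vanish at the edge of the board.
    have hV : ∑ i ∈ Finset.range (N + 2), (if G.V i j = true then (1 : ZMod 2) else 0) =
        ∑ i ∈ Finset.range (N + 2), (if G.V (i + 1) j = true then (1 : ZMod 2) else 0) := by
      have h1 := Finset.sum_range_succ
        (fun i => if G.V i j = true then (1 : ZMod 2) else 0) (N + 2)
      have h2 := Finset.sum_range_succ'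
        (fun i => if G.V i j = true then (1 : ZMod 2) else 0) (N + 2)
      rw [h1] at h2
      simpa [G.V_zero, G.V_end] using h2
    have key : ∑ i ∈ Finset.range (N + 2), (if G.H i (j + 1) = true then (1 : ZMod 2) else 0) =
        ∑ i ∈ Finset.range (N + 2), ((if G.H i j = true then (1 : ZMod 2) else 0) +
          ((if G.V i j = true then (1 : ZMod 2) else 0) +
            (if G.V (i + 1) j = true then (1 : ZMod 2) else 0))) := by
      refine Finset.sum_congr rfl fun i hi => ?_
      have := G.even_tile i j (by have := Finset.mem_range.1 hi; omega) (by omega)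
      revert this
      cases G.H i j <;> cases G.H i (j + 1) <;> cases G.V i j <;> cases G.V (i + 1) j <;>
        simp <;> decide
    rw [key, Finset.sum_add_distrib, Finset.sum_add_distrib, h0, hV, zero_add]
    exact CharTwo.add_self_eq_zero _

open Classical in
/-- The columns `c` such that the line between the columns `c` and `c + 1` is crossed in every
interior row and in the first row. -/
noncomputable def fullCuts : Finset ℕ :=
  (Finset.Icc 1 (N - 1)).filter fun c =>
    G.H 0 (c + 1) = true ∧ ∀ i ∈ Finset.Icc 1 N, G.H i (c + 1) = true

/-- This is where the parity of the board enters: the line is crossed an even number of times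
altogether and `N` times in the interior, so the two boundary rows agree. -/
theorem H_last_eq (hN : Even N) {c : ℕ} (hc : c ≤ N)
    (h : ∀ i, 1 ≤ i → i ≤ N → G.H i (c + 1) = true) : G.H (N + 1) (c + 1) = G.H 0 (c + 1) := by
  have hs := G.sum_H_eq_zero (c + 1) (by omega)
  rw [Finset.sum_range_succ, Finset.sum_range_succ'] at hs
  have h1 : ∑ i ∈ Finset.range N, (if G.H (i + 1) (c + 1) = true then (1 : ZMod 2) else 0) =
      0 := by
    rw [Finset.sum_congr rfl (g := fun _ => (1 : ZMod 2))]
    · simpa using (ZMod.natCast_eq_zero_iff_even).2 hN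
    · intro i hi
      rw [Finset.mem_range] at hi
      simp [h (i + 1) (by omega) (by omega)]
  rw [h1] at hs
  revert hs
  cases G.H (N + 1) (c + 1) <;> cases G.H 0 (c + 1) <;> simp

theorem mem_fullCuts {c : ℕ} (hc : c ∈ G.fullCuts) :
    1 ≤ c ∧ c + 1 ≤ N ∧ G.H 0 (c + 1) = true ∧ ∀ i, 1 ≤ i → i ≤ N → G.H i (c + 1) = true := by
  simp only [fullCuts, Finset.mem_filter, Finset.mem_Icc] at hc
  exact ⟨by omega, by omega, hc.2.1, fun i h h' => hc.2.2 i ⟨h, h'⟩⟩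

theorem mem_fullCuts_of {c : ℕ} (h1 : 1 ≤ c) (h2 : c + 1 ≤ N) (h3 : G.H 0 (c + 1) = true)
    (h4 : ∀ i, 1 ≤ i → i ≤ N → G.H i (c + 1) = true) : c ∈ G.fullCuts := by
  simp only [fullCuts, Finset.mem_filter, Finset.mem_Icc]
  exact ⟨by omega, h3, fun i h => h4 i h.1 h.2⟩

theorem le_card_D_of_column {c : ℕ} (h : ∀ i, 1 ≤ i → i ≤ N → (i, c) ∈ G.D) :
    N ≤ G.D.card := by
  have := Finset.card_le_card_of_injOn (s := Finset.Icc 1 N) (t := G.D) (fun i => (i, c))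
    (fun i hi => by
      rw [Finset.mem_coe, Finset.mem_Icc] at hi
      exact h i hi.1 hi.2)
    (fun i _ j _ hij => (Prod.mk.inj hij).1)
  simpa using this

/-- Between two consecutive full cuts the left and right sides of every tile of the column cancel
modulo 2. Starting from the unmet edge of the board, no horizontal side of the column is met, so
none of its `N` interior tiles is a crossing. -/
theorem succ_notMem_fullCuts (hD : G.D.card < N) {c : ℕ} (hc : c ∈ G.fullCuts) :
    c + 1 ∉ G.fullCuts := by
  intro hc'
  obtain ⟨h1, h2, h3, h4⟩ := G.mem_fullCuts hc
  obtain ⟨h1', h2', h3', h4'⟩ := G.mem_fullCuts hc'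
  have hV : ∀ i, i ≤ N → G.V (i + 1) (c + 1) = false := by
    intro i
    induction i with
    | zero =>
      intro _
      have := G.even_tile 0 (c + 1) (by omega) (by omega)
      simpa [h3, h3', G.V_zero] using this
    | succ i ih =>
      intro hi
      have := G.even_tile (i + 1) (c + 1) (by omega) (by omega)
      simpa [h4 (i + 1) (by omega) hi, h4' (i + 1) (by omega) hi, ih (by omega)] using this
  refine absurd (G.le_card_D_of_column (c := c + 1) fun i hi hi' => ?_) (by omega)
  by_contra hn
  have := (G.crossing i (c + 1) hi hi' (by omega) (by omega) hn).2.2.1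
  obtain ⟨i, rfl⟩ := Nat.exists_eq_add_of_le' hi
  rw [hV i (by omega)] at this
  exact absurd this (by decide)

/-- Each of the `q` pairs {2j, 2j + 1} contains at most one full cut. -/
theorem card_fullCuts_le {q : ℕ} (hN : N = 2 * q) (hD : G.D.card < N) :
    G.fullCuts.card ≤ q := by
  have := Finset.card_le_card_of_injOn (s := G.fullCuts) (t := Finset.range q) (fun c => c / 2)
    (fun c hc => by
      have := G.mem_fullCuts hc
      simp only [Finset.coe_range, Set.mem_Iio]
      omega)
    (fun a ha b hb hab => by
      have h1 := G.succ_notMem_fullCuts hD ha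
      have h2 := G.succ_notMem_fullCuts hD hb
      by_contra hne
      have : b = a + 1 ∨ a = b + 1 := by simp only at hab; omega
      rcases this with rfl | rfl
      · exact h1 hb
      · exact h2 ha)
  simpa using this

/-- The same pairs {2j, 2j + 1}; without the cut 1 the pair with j = 0 is not used. -/
theorem card_fullCuts_lt_of_one {q : ℕ} (hN : N = 2 * q) (hD : G.D.card < N)
    (h : 1 ∉ G.fullCuts) : G.fullCuts.card ≤ q - 1 := by
  have := Finset.card_le_card_of_injOn (s := G.fullCuts) (t := Finset.Icc 1 (q - 1))
    (fun c => c / 2)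
    (fun c hc => by
      have := G.mem_fullCuts hc
      have : c ≠ 1 := by rintro rfl; exact h hc
      simp only [Finset.coe_Icc, Set.mem_Icc]
      omega)
    (fun a ha b hb hab => by
      have h1 := G.succ_notMem_fullCuts hD ha
      have h2 := G.succ_notMem_fullCuts hD hb
      by_contra hne
      have : b = a + 1 ∨ a = b + 1 := by simp only at hab; omega
      rcases this with rfl | rfl
      · exact h1 hb
      · exact h2 ha)
  simpa using this

/-- The pairing is shifted to {2j - 1, 2j}, so that leaving out the cut `N - 1` removes the last
pair. If the bound is attained, injectivity makes every remaining pair contain a full cut. -/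
theorem exists_mem_fullCuts_of_last {q : ℕ} (hN : N = 2 * q) (hD : G.D.card < N)
    (h : N - 1 ∉ G.fullCuts) :
    G.fullCuts.card ≤ q - 1 ∧
      (q - 1 ≤ G.fullCuts.card → ∀ j, 1 ≤ j → j + 1 ≤ q → ∃ c ∈ G.fullCuts, (c + 1) / 2 = j) := by
  have hmaps : Set.MapsTo (fun c => (c + 1) / 2) (G.fullCuts : Set ℕ)
      (Finset.Icc 1 (q - 1) : Finset ℕ) := fun c hc => by
    have := G.mem_fullCuts hc
    have : c ≠ N - 1 := by rintro rfl; exact h hc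
    simp only [Finset.coe_Icc, Set.mem_Icc]
    omega
  have hinj : Set.InjOn (fun c => (c + 1) / 2) (G.fullCuts : Set ℕ) := fun a ha b hb hab => by
    have h1 := G.succ_notMem_fullCuts hD ha
    have h2 := G.succ_notMem_fullCuts hD hb
    by_contra hne
    have : b = a + 1 ∨ a = b + 1 := by simp only at hab; omega
    rcases this with rfl | rfl
    · exact h1 hb
    · exact h2 ha
  refine ⟨by simpa using Finset.card_le_card_of_injOn _ hmaps hinj, fun hq j hj hj' => ?_⟩
  obtain ⟨c, hc, hcj⟩ := Finset.surj_on_of_inj_on_of_card_le (s := G.fullCuts)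
    (t := Finset.Icc 1 (q - 1)) (fun c _ => (c + 1) / 2) (fun c hc => hmaps hc)
    (fun a b ha hb hab => hinj ha hb hab) (by simpa using hq) j
    (Finset.mem_Icc.2 ⟨hj, by omega⟩)
  exact ⟨c, hc, hcj.symm⟩

/-- If the cuts at both ends are not full, a full set of full cuts consists of the even ones. -/
theorem two_mul_mem_fullCuts {q : ℕ} (hN : N = 2 * q) (hD : G.D.card < N)
    (h1 : 1 ∉ G.fullCuts) (h : N - 1 ∉ G.fullCuts) (hq : q - 1 ≤ G.fullCuts.card) (j : ℕ)
    (hj : 1 ≤ j) (hj' : j + 1 ≤ q) : 2 * j ∈ G.fullCuts := by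
  induction j, hj using Nat.le_induction with
  | base =>
    obtain ⟨c, hc, hcj⟩ := (G.exists_mem_fullCuts_of_last hN hD h).2 hq 1 le_rfl hj'
    have : c ≠ 1 := by rintro rfl; exact h1 hc
    have : c = 2 * 1 := by omega
    rwa [← this]
  | succ j hj ih =>
    obtain ⟨c, hc, hcj⟩ := (G.exists_mem_fullCuts_of_last hN hD h).2 hq (j + 1) (by omega) hj'
    have : c ≠ 2 * j + 1 := by
      rintro rfl
      exact G.succ_notMem_fullCuts hD (ih (by omega)) hc
    have : c = 2 * (j + 1) := by omega
    rwa [← this]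

/-! ### Links between rows and columns, and the spanning tree -/

/-- The positions of the four corner tiles of the interior. -/
def corners (N : ℕ) : Finset (ℕ × ℕ) := {(1, 1), (1, N), (N, 1), (N, N)}

/-- Whether the first row and the first column of the interior are joined around the corner of
the board, and similarly for the other three corners. -/
def cornerSide (p : ℕ × ℕ) : Bool :=
  G.V (if p.1 = 1 then 1 else N + 1) (if p.2 = 1 then 0 else N + 1)

/-- The crossings at the corners of the interior around which two strands are joined. -/
def crossedCorners : Finset (ℕ × ℕ) :=
  (corners N).filter fun p => p ∉ G.D ∧ G.cornerSide p = true

/-- `L` links rows to columns in such a way that every non-crossing tile and every crossed corner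
links its row to its column. -/
def Spans (L : Finset (ℕ × ℕ)) : Prop :=
  ∀ fr fc : ℕ → ZMod 2, (∀ p ∈ L, fr p.1 = fc p.2) →
    ∀ p ∈ G.D ∪ G.crossedCorners, fr p.1 = fc p.2

/-- A corner tile of the board has only two sides off the edge, and by parity both or neither are
met. This makes `cornerSide` symmetric in rows and columns. -/
theorem cornerSide_eq_H {p : ℕ × ℕ} (hN : 2 ≤ N) (hp : p ∈ corners N) :
    G.cornerSide p = G.H (if p.1 = 1 then 0 else N + 1) (if p.2 = 1 then 1 else N + 1) := by
  have h1 := G.even_tile 0 0 (by omega) (by omega)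
  have h2 := G.even_tile 0 (N + 1) (by omega) (by omega)
  have h3 := G.even_tile (N + 1) 0 (by omega) (by omega)
  have h4 := G.even_tile (N + 1) (N + 1) (by omega) (by omega)
  have hN1 : N ≠ 1 := by omega
  simp only [G.H_zero, G.V_zero, G.H_end, G.V_end, zero_add] at h1 h2 h3 h4
  simp only [corners, Finset.mem_insert, Finset.mem_singleton] at hp
  rcases hp with rfl | rfl | rfl | rfl <;> simp [cornerSide, hN1] <;> simp_all

/-- If some interior row misses the cut, the two tiles beside it in that row are non-crossings and
link both columns to this row. Otherwise the cut is full. -/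
theorem fc_eq_of_H (hN : Even N) {fr fc : ℕ → ZMod 2}
    (hL : ∀ p ∈ G.D, fr p.1 = fc p.2) (hA : ∀ c ∈ G.fullCuts, fc c = fc (c + 1)) {c : ℕ}
    (hc : 1 ≤ c) (hc' : c + 1 ≤ N)
    (h : G.H 0 (c + 1) = true ∨ G.H (N + 1) (c + 1) = true) : fc c = fc (c + 1) := by
  by_cases hall : ∀ i, 1 ≤ i → i ≤ N → G.H i (c + 1) = true
  · have := G.H_last_eq hN (by omega) hall
    exact hA c (G.mem_fullCuts_of hc hc' (by rcases h with h | h <;> simp_all) hall)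
  · push Not at hall
    obtain ⟨i, hi, hi', hn⟩ := hall
    have h1 : (i, c) ∈ G.D := by
      by_contra hD
      exact hn (G.crossing i c hi hi' hc (by omega) hD).2.1
    have h2 : (i, c + 1) ∈ G.D := by
      by_contra hD
      exact hn (G.crossing i (c + 1) hi hi' (by omega) (by omega) hD).1
    exact (hL _ h1).symm.trans (hL _ h2)

/-- Labels of the rows and columns that agree along non-crossing tiles, full cuts and crossed
corners are all equal. -/
theorem labels_eq (hN : Even N) (hN2 : 2 ≤ N) (hD : G.D.card < N) {fr fc : ℕ → ZMod 2}
    (hL : ∀ p ∈ G.D ∪ G.crossedCorners, fr p.1 = fc p.2)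
    (hA : ∀ c ∈ G.fullCuts, fc c = fc (c + 1))
    (hB : ∀ c ∈ G.transpose.fullCuts, fr c = fr (c + 1)) :
    ∃ a, ∀ i, 1 ≤ i → i ≤ N → fr i = a ∧ fc i = a := by
  have hLD : ∀ p ∈ G.D, fr p.1 = fc p.2 := fun p hp => hL p (Finset.mem_union_left _ hp)
  have hcol := fun c => G.fc_eq_of_H hN hLD hA (c := c)
  have hrow := fun c => G.transpose.fc_eq_of_H hN (fr := fc) (fc := fr) (fun p hp =>
    (hLD (p.2, p.1) (G.mem_transpose_D.1 hp)).symm) hB (c := c)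
  have hcorn : ∀ p ∈ corners N, G.cornerSide p = true → fr p.1 = fc p.2 := by
    intro p hp hs
    by_cases hpD : p ∈ G.D
    · exact hLD p hpD
    · refine hL p (Finset.mem_union_right _ ?_)
      simp only [crossedCorners, Finset.mem_filter]
      exact ⟨hp, hpD, hs⟩
  obtain ⟨a, ha⟩ := G.connected
    -- A horizontal side in a boundary row gets the label of the column on its left; the leftmost
    -- ones, where there is no such column, get the label of column 1. A tile of a boundary row can
    -- then conflict only at its left side (away from the corners), which `hcol` settles. Boundary
    -- columns are treated likewise.
    (fun i j => if 1 ≤ i ∧ i ≤ N then fr i else if j ≤ 1 then fc 1 else fc (j - 1))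
    (fun i j => if 1 ≤ j ∧ j ≤ N then fc j else if i ≤ 1 then fr 1 else fr (i - 1))
    (fun i j hi hi' hj hj' _ => by simp [hi, hi', hj, hj'])
    (fun i j hi hj hn => by
      by_cases hi1 : 1 ≤ i ∧ i ≤ N <;> by_cases hj1 : 1 ≤ j ∧ j ≤ N
      · have hij : (i, j) ∈ G.D := by tauto
        have := hLD _ hij
        exact ⟨fr i, by simp_all⟩
      · refine ⟨fr i, by simp [hi1], by simp [hi1], fun h => ?_, fun h => ?_⟩
        · by_cases h1 : i ≤ 1
          · obtain rfl : i = 1 := by omega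
            simp [hj1]
          · obtain ⟨c, rfl⟩ := Nat.exists_eq_add_of_le' hi1.1
            have : j = 0 ∨ j = N + 1 := by omega
            simpa [hj1, h1] using hrow c (by omega) (by omega)
              (by rcases this with rfl | rfl <;> simp [transpose, h])
        · have h1 : ¬ i + 1 ≤ 1 := by omega
          simp [hj1, h1]
      · refine ⟨fc j, fun h => ?_, fun h => ?_, by simp [hj1], by simp [hj1]⟩
        · by_cases h1 : j ≤ 1
          · obtain rfl : j = 1 := by omega
            simp [hi1]
          · obtain ⟨c, rfl⟩ := Nat.exists_eq_add_of_le' hj1.1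
            have : i = 0 ∨ i = N + 1 := by omega
            simpa [hi1, h1] using hcol c (by omega) (by omega)
              (by rcases this with rfl | rfl <;> simp [h])
        · have h1 : ¬ j + 1 ≤ 1 := by omega
          simp [hi1, h1]
      · have hi2 : i = 0 ∨ i = N + 1 := by omega
        have hj2 : j = 0 ∨ j = N + 1 := by omega
        have hN0 : N ≠ 0 := by omega
        have hN1 : N ≠ 1 := by omega
        have c1 := hcorn (1, 1) (by simp [corners])
        have c2 := hcorn (1, N) (by simp [corners])
        have c3 := hcorn (N, 1) (by simp [corners])
        have c4 := hcorn (N, N) (by simp [corners])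
        rw [G.cornerSide_eq_H hN2 (by simp [corners])] at c1 c2 c3 c4
        have b1 := G.H_zero
        have b2 := G.H_end
        have b3 := G.V_zero
        have b4 := G.V_end
        simp only [hN1, if_true, if_false] at c1 c2 c3 c4
        rcases hi2 with rfl | rfl <;> rcases hj2 with rfl | rfl
        · exact ⟨fr 1, by simp_all⟩
        · exact ⟨fr 1, by simp_all⟩
        · exact ⟨fr N, by simp_all⟩
        · exact ⟨fr N, by simp_all⟩)
  -- Every row and every column contains a crossing, as there are fewer than `N` non-crossings. So
  -- each label occurs on a side that is met.
  refine ⟨a, fun i hi hi' => ⟨?_, ?_⟩⟩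
  · obtain ⟨j, hj, hj', hn⟩ : ∃ j, 1 ≤ j ∧ j ≤ N ∧ (i, j) ∉ G.D := by
      by_contra! hcon
      have := G.transpose.le_card_D_of_column (c := i) fun j hj hj' =>
        G.mem_transpose_D.2 (hcon j hj hj')
      rw [G.card_transpose_D] at this
      omega
    have := (ha i j (by omega) (by omega)).1 (G.crossing i j hi hi' hj hj' hn).1
    simpa [hi, hi'] using this
  · obtain ⟨j, hj, hj', hn⟩ : ∃ j, 1 ≤ j ∧ j ≤ N ∧ (j, i) ∉ G.D := by
      by_contra! hcon
      have := G.le_card_D_of_column (c := i) hcon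
      omega
    have := (ha j i (by omega) (by omega)).2 (G.crossing j i hj hj' hi hi' hn).2.2.1
    simpa [hi, hi'] using this

/-- The edge count for the graph with the rows as `Sum.inl`, the columns as `Sum.inr`, and the links
of `L` together with the full cuts in both directions as edges. -/
theorem two_mul_le_of_spans (hN : Even N) (hN2 : 2 ≤ N) (hD : G.D.card < N)
    {L : Finset (ℕ × ℕ)} (hL : G.Spans L) :
    2 * N ≤ L.card + G.fullCuts.card + G.transpose.fullCuts.card + 1 := by
  let E : Finset ((ℕ ⊕ ℕ) × (ℕ ⊕ ℕ)) :=
    (L.image fun p => (Sum.inl p.1, Sum.inr p.2)) ∪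
      (G.fullCuts.image fun c => (Sum.inr c, Sum.inr (c + 1))) ∪
      (G.transpose.fullCuts.image fun c => (Sum.inl c, Sum.inl (c + 1)))
  have hE : E.card ≤ L.card + G.fullCuts.card + G.transpose.fullCuts.card :=
    (Finset.card_union_le _ _).trans (add_le_add ((Finset.card_union_le _ _).trans
      (add_le_add Finset.card_image_le Finset.card_image_le)) Finset.card_image_le)
  have := card_le_card_edges_add_one ((Finset.Icc 1 N).disjSum (Finset.Icc 1 N)) E
    (fun f hf => by
      obtain ⟨a, ha⟩ := G.labels_eq hN hN2 hD (fr := fun i => f (Sum.inl i))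
        (fc := fun i => f (Sum.inr i))
        (hL (fun i => f (Sum.inl i)) (fun i => f (Sum.inr i)) fun p hp => hf (Sum.inl p.1, Sum.inr p.2) (by
          simp only [E, Finset.mem_union, Finset.mem_image]
          exact Or.inl (Or.inl ⟨p, hp, rfl⟩)))
        (fun c hc => hf (Sum.inr c, Sum.inr (c + 1)) (by
          simp only [E, Finset.mem_union, Finset.mem_image]
          exact Or.inl (Or.inr ⟨c, hc, rfl⟩)))
        (fun c hc => hf (Sum.inl c, Sum.inl (c + 1)) (by
          simp only [E, Finset.mem_union, Finset.mem_image]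
          exact Or.inr ⟨c, hc, rfl⟩))
      have hc : ∀ u ∈ (Finset.Icc 1 N).disjSum (Finset.Icc 1 N), f u = a := by
        rintro (u | u) hu <;> simp only [Finset.inl_mem_disjSum, Finset.inr_mem_disjSum,
          Finset.mem_Icc] at hu
        · exact (ha u hu.1 hu.2).1
        · exact (ha u hu.1 hu.2).2
      intro u hu v hv
      rw [hc u hu, hc v hv])
  simp only [Finset.card_disjSum, Nat.card_Icc] at this
  omega

theorem mem_corners {N : ℕ} {p : ℕ × ℕ} :
    p ∈ corners N ↔ (p.1 = 1 ∨ p.1 = N) ∧ (p.2 = 1 ∨ p.2 = N) := by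
  obtain ⟨i, j⟩ := p
  simp only [corners, Finset.mem_insert, Finset.mem_singleton, Prod.mk.injEq]
  tauto

theorem mem_crossedCorners {p : ℕ × ℕ} :
    p ∈ G.crossedCorners ↔ p ∈ corners N ∧ p ∉ G.D ∧ G.cornerSide p = true := by
  simp [crossedCorners]

theorem swap_mem_crossedCorners (hN : 2 ≤ N) {p : ℕ × ℕ} (hp : p ∈ G.crossedCorners) :
    p.swap ∈ G.transpose.crossedCorners := by
  obtain ⟨i, j⟩ := p
  rw [mem_crossedCorners, mem_corners] at *
  refine ⟨hp.1.symm, fun h => hp.2.1 (G.mem_transpose_D.1 h), ?_⟩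
  have h := hp.2.2
  rw [G.cornerSide_eq_H hN (mem_corners.2 hp.1)] at h
  exact h

/-- In the boundary row next to the corner, the strand coming around the corner meets the vertical
strand of the crossing in one boundary tile. By parity it does not continue along the edge, so the
adjacent cut is missed there. For the last row, `H_last_eq` carries this over to the first row. -/
theorem notMem_fullCuts_of_crossedCorner (hN : Even N) (hN2 : 2 ≤ N) {p : ℕ × ℕ}
    (hp : p ∈ G.crossedCorners) :
    (p.2 = 1 → 1 ∉ G.fullCuts) ∧ (p.2 = N → N - 1 ∉ G.fullCuts) := by
  obtain ⟨i, j⟩ := p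
  rw [mem_crossedCorners, mem_corners] at hp
  obtain ⟨hc, hpD, hs⟩ := hp
  have hs' := hs
  rw [G.cornerSide_eq_H hN2 (mem_corners.2 hc)] at hs'
  have hcr := G.crossing i j (by simp at hc; omega) (by simp at hc; omega)
    (by simp at hc; omega) (by simp at hc; omega) hpD
  have hN1 : N ≠ 1 := by omega
  constructor
  · rintro rfl hm
    obtain ⟨h1, h2, h3, h4⟩ := G.mem_fullCuts hm
    have h5 := G.H_last_eq hN (by omega) h4
    have e1 := G.even_tile 0 1 (by omega) (by omega)
    have e2 := G.even_tile (N + 1) 1 (by omega) (by omega)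
    have b3 := G.V_zero 1
    have b4 := G.V_end 1
    rcases hc.1 with h | h <;> simp only at h <;> subst h <;> simp_all
  · rintro rfl hm
    obtain ⟨h1, h2, h3, h4⟩ := G.mem_fullCuts hm
    have h5 := G.H_last_eq hN (by omega) h4
    simp only at *
    rw [Nat.sub_add_cancel (by omega)] at h3 h5
    have e1 := G.even_tile 0 j (by omega) (by omega)
    have e2 := G.even_tile (j + 1) j (by omega) (by omega)
    have b3 := G.V_zero j
    have b4 := G.V_end j
    rcases hc.1 with h | h <;> subst h <;> simp_all

theorem card_fullCuts_le_of_crossedCorner {q : ℕ} (hN : N = 2 * q) (hN2 : 2 ≤ N)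
    (hD : G.D.card < N) (hC : G.crossedCorners.Nonempty) : G.fullCuts.card ≤ q - 1 := by
  obtain ⟨p, hp⟩ := hC
  have h := G.notMem_fullCuts_of_crossedCorner (hN ▸ even_two_mul q) hN2 hp
  rcases (mem_corners.1 (G.mem_crossedCorners.1 hp).1).2 with h1 | h1
  · exact G.card_fullCuts_lt_of_one hN hD (h.1 h1)
  · exact (G.exists_mem_fullCuts_of_last hN hD (h.2 h1)).1

/-- Three crossed corners suffice to join the first and last rows and columns. -/
theorem eq_of_three_corners {N : ℕ} (hN : 2 ≤ N) {C : Finset (ℕ × ℕ)} (hC : C ⊆ corners N)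
    (h3 : C.card = 3) {fr fc : ℕ → ZMod 2} (h : ∀ p ∈ C, fr p.1 = fc p.2) :
    ∀ p ∈ corners N, fr p.1 = fc p.2 := by
  have hN1 : 1 ≠ N := by omega
  have hN1' : N ≠ 1 := by omega
  have hcard : (corners N).card = 4 := by
    simp [corners, hN1, hN1']
  obtain ⟨x, hx⟩ : ∃ x, corners N \ C = {x} := by
    rw [← Finset.card_eq_one, Finset.card_sdiff_of_subset hC]
    omega
  have hmem : ∀ p ∈ corners N, p ≠ x → fr p.1 = fc p.2 := by
    intro p hp hpx
    refine h p ?_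
    by_contra hn
    have : p ∈ corners N \ C := Finset.mem_sdiff.2 ⟨hp, hn⟩
    rw [hx, Finset.mem_singleton] at this
    exact hpx this
  have hxc : x ∈ corners N := (Finset.mem_sdiff.1 (hx ▸ Finset.mem_singleton_self x)).1
  have c1 := hmem (1, 1) (by simp [corners])
  have c2 := hmem (1, N) (by simp [corners])
  have c3 := hmem (N, 1) (by simp [corners])
  have c4 := hmem (N, N) (by simp [corners])
  intro p hp
  by_cases hpx : p = x
  · subst hpx
    simp only [corners, Finset.mem_insert, Finset.mem_singleton] at hp
    rcases hp with rfl | rfl | rfl | rfl <;> simp_all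
  · exact hmem p hp hpx

/-- The structure of a one-component grid with few non-crossing tiles: the non-crossing tiles are
the edges of a spanning tree. -/
theorem exists_crossedCorners {q : ℕ} (hN : N = 2 * q) (hN2 : 2 ≤ N) (hD : G.D.card + 2 ≤ N) :
    (∃ C ⊆ G.crossedCorners, C.card = 3) ∧ q - 1 ≤ G.fullCuts.card ∧
      q - 1 ≤ G.transpose.fullCuts.card ∧
      ∀ L : Finset (ℕ × ℕ), G.Spans L → N + 1 ≤ L.card := by
  have hev : Even N := hN ▸ even_two_mul q
  have hDT : G.transpose.D.card < N := by rw [G.card_transpose_D]; omega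
  have hspan : G.Spans (G.D ∪ G.crossedCorners) := fun _ _ h => h
  have hcount := G.two_mul_le_of_spans hev hN2 (by omega) hspan
  have hle : (G.D ∪ G.crossedCorners).card ≤ G.D.card + G.crossedCorners.card :=
    Finset.card_union_le _ _
  have hA := G.card_fullCuts_le hN (by omega)
  have hB := G.transpose.card_fullCuts_le hN hDT
  -- Without crossed corners the count would give 2N ≤ (N - 2) + 2q + 1 = 2N - 1.
  have hne : G.crossedCorners.Nonempty := by
    rw [Finset.nonempty_iff_ne_empty]
    intro h
    have h0 : G.crossedCorners.card = 0 := by rw [h, Finset.card_empty]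
    omega
  have hneT : G.transpose.crossedCorners.Nonempty :=
    hne.imp' Prod.swap fun _ hp => G.swap_mem_crossedCorners hN2 hp
  have hA' := G.card_fullCuts_le_of_crossedCorner hN hN2 (by omega) hne
  have hB' := G.transpose.card_fullCuts_le_of_crossedCorner hN hN2 hDT hneT
  -- Now 2N ≤ (N - 2) + |corners| + 2(q - 1) + 1.
  have hC : 3 ≤ G.crossedCorners.card := by omega
  obtain ⟨C, hCs, hC3⟩ := Finset.exists_subset_card_eq hC
  have hspan3 : G.Spans (G.D ∪ C) := by
    intro fr fc h p hp
    rcases Finset.mem_union.1 hp with hp | hp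
    · exact h p (Finset.mem_union_left _ hp)
    · exact eq_of_three_corners hN2 (hCs.trans (Finset.filter_subset _ _)) hC3
        (fun p hp => h p (Finset.mem_union_right _ hp)) p (G.mem_crossedCorners.1 hp).1
  have hcount3 := G.two_mul_le_of_spans hev hN2 (by omega) hspan3
  have hle3 : (G.D ∪ C).card ≤ G.D.card + C.card := Finset.card_union_le _ _
  -- With three corners the count becomes an equality, so both numbers of full cuts equal `q - 1`.
  refine ⟨⟨C, hCs, hC3⟩, by omega, by omega, fun L hL => ?_⟩
  have := G.two_mul_le_of_spans hev hN2 (by omega) hL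
  omega

/-! ### Consequences of the tree structure -/

/-- No link given by a non-crossing tile follows from the other ones. -/
theorem not_redundant {q : ℕ} (hN : N = 2 * q) (hN2 : 2 ≤ N) (hD : G.D.card + 2 ≤ N)
    {d : ℕ × ℕ} (hd : d ∈ G.D)
    (h : ∀ fr fc : ℕ → ZMod 2, (∀ p ∈ G.D, p ≠ d → fr p.1 = fc p.2) →
      (∀ p ∈ corners N, fr p.1 = fc p.2) → fr d.1 = fc d.2) : False := by
  obtain ⟨⟨C, hCs, hC3⟩, -, -, hcount⟩ := G.exists_crossedCorners hN hN2 hD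
  have hspan : G.Spans (G.D.erase d ∪ C) := by
    intro fr fc hL
    have hcor := eq_of_three_corners hN2 (hCs.trans (Finset.filter_subset _ _)) hC3
        (fun p hp => hL p (Finset.mem_union_right _ hp))
    have hDd : ∀ p ∈ G.D, p ≠ d → fr p.1 = fc p.2 := fun p hp hpd =>
      hL p (Finset.mem_union_left _ (Finset.mem_erase.2 ⟨hpd, hp⟩))
    intro p hp
    by_cases hpd : p = d
    · subst hpd
      exact h fr fc hDd hcor
    · rcases Finset.mem_union.1 hp with hp | hp
      · exact hDd p hp hpd
      · exact hcor p (G.mem_crossedCorners.1 hp).1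
  have h1 := hcount _ hspan
  have h2 : (G.D.erase d ∪ C).card ≤ (G.D.erase d).card + C.card := Finset.card_union_le _ _
  have h3 := Finset.card_erase_add_one hd
  omega

/-- Its link would duplicate a corner link, and all of these follow from three crossed corners. -/
theorem corner_notMem {q : ℕ} (hN : N = 2 * q) (hN2 : 2 ≤ N) (hD : G.D.card + 2 ≤ N)
    {d : ℕ × ℕ} (hd : d ∈ corners N) : d ∉ G.D :=
  fun h => G.not_redundant hN hN2 hD h fun _ _ _ h' => h' d hd

/-- The four positions are the edges of a 4-cycle in the bipartite graph, so three of the links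
imply the fourth. A corner position may serve as one of the three. -/
theorem rectangle_notMem {q : ℕ} (hN : N = 2 * q) (hN2 : 2 ≤ N) (hD : G.D.card + 2 ≤ N)
    {r r' c c' : ℕ} (hr : r ≠ r') (hc : c ≠ c') (h1 : (r, c) ∈ G.D ∨ (r, c) ∈ corners N)
    (h2 : (r, c') ∈ G.D) (h3 : (r', c) ∈ G.D) : (r', c') ∉ G.D := by
  intro hd
  refine G.not_redundant hN hN2 hD hd fun fr fc hL hcor => ?_
  have e1 : fr r = fc c := by
    rcases h1 with h1 | h1
    · exact hL _ h1 (by simp [hr])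
    · exact hcor _ h1
  have e2 : fr r = fc c' := hL _ h2 (by simp [hr])
  have e3 : fr r' = fc c := hL _ h3 (by simp [hc])
  exact e3.trans (e1.symm.trans e2)

/-- Every even cut is full. -/
theorem H_even {q : ℕ} (hN : N = 2 * q) (hN2 : 2 ≤ N) (hD : G.D.card + 2 ≤ N) {j : ℕ}
    (hj : 1 ≤ j) (hj' : j + 1 ≤ q) {i : ℕ} (hi : i ≤ N + 1) : G.H i (2 * j + 1) = true := by
  obtain ⟨⟨C, hCs, hC3⟩, hA, -, -⟩ := G.exists_crossedCorners hN hN2 hD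
  have hev : Even N := hN ▸ even_two_mul q
  -- Only two corners lie in any one column, so three crossed corners include one in the first and
  -- one in the last column. This excludes the cuts 1 and `N - 1`.
  have hcol : ∀ x y : ℕ, (∀ p ∈ corners N, p.2 = x ∨ p.2 = y) → x ≠ y →
      ∃ p ∈ G.crossedCorners, p.2 = x := by
    intro x y hxy hne
    by_contra! hcon
    have hsub : C ⊆ {(1, y), (N, y)} := by
      intro p hp
      have hpc := (G.mem_crossedCorners.1 (hCs hp)).1
      have h2 := (hxy p hpc).resolve_left (hcon p (hCs hp))
      have h1 := (mem_corners.1 hpc).1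
      obtain ⟨a, b⟩ := p
      simp only [Finset.mem_insert, Finset.mem_singleton, Prod.mk.injEq]
      simp only at h1 h2
      tauto
    have := (Finset.card_le_card hsub).trans Finset.card_le_two
    omega
  obtain ⟨p, hp, hp1⟩ := hcol 1 N (fun p hp => (mem_corners.1 hp).2) (by omega)
  obtain ⟨p', hp', hpN⟩ := hcol N 1 (fun p hp => (mem_corners.1 hp).2.symm) (by omega)
  have hm := G.two_mul_mem_fullCuts hN (by omega)
    ((G.notMem_fullCuts_of_crossedCorner hev hN2 hp).1 hp1)
    ((G.notMem_fullCuts_of_crossedCorner hev hN2 hp').2 hpN) hA j hj hj'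
  obtain ⟨h1, h2, h3, h4⟩ := G.mem_fullCuts hm
  have h5 := G.H_last_eq hev (by omega) h4
  rcases Nat.eq_zero_or_pos i with rfl | hi0
  · exact h3
  · rcases Nat.lt_or_ge N i with h | h
    · obtain rfl : i = N + 1 := by omega
      rw [h5, h3]
    · exact h4 i hi0 h

theorem V_even {q : ℕ} (hN : N = 2 * q) (hN2 : 2 ≤ N) (hD : G.D.card + 2 ≤ N) {i : ℕ}
    (hi : 1 ≤ i) (hi' : i + 1 ≤ q) {j : ℕ} (hj : j ≤ N + 1) : G.V (2 * i + 1) j = true :=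
  G.transpose.H_even hN hN2 (by rwa [G.card_transpose_D]) hi hi' hj

end SideGrid

/-! ### Blocks of four tiles -/

/-- The case analysis for a block of four tiles. -/
theorem block_sides {A₀ A₁ B₀ B₁ d₁₁ d₁₂ d₂₁ d₂₂ : Prop}
    {l₁ l₂ x₁ x₂ b₁ b₂ t₁ t₂ h₁ h₂ v₁ v₂ : Bool}
    (hA : ¬ (A₀ ∧ A₁)) (hB : ¬ (B₀ ∧ B₁))
    (hl : ¬ B₀ → l₁ = true ∧ l₂ = true) (hx : ¬ B₁ → x₁ = true ∧ x₂ = true)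
    (hb : ¬ A₀ → b₁ = true ∧ b₂ = true) (ht : ¬ A₁ → t₁ = true ∧ t₂ = true)
    (p₁₁ : (l₁ ^^ h₁ ^^ b₁ ^^ v₁) = false) (p₁₂ : (h₁ ^^ x₁ ^^ b₂ ^^ v₂) = false)
    (p₂₁ : (l₂ ^^ h₂ ^^ v₁ ^^ t₁) = false) (p₂₂ : (h₂ ^^ x₂ ^^ v₂ ^^ t₂) = false)
    (k₁₁ : ¬ d₁₁ → l₁ = true ∧ h₁ = true ∧ b₁ = true ∧ v₁ = true)
    (k₁₂ : ¬ d₁₂ → h₁ = true ∧ x₁ = true ∧ b₂ = true ∧ v₂ = true)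
    (k₂₁ : ¬ d₂₁ → l₂ = true ∧ h₂ = true ∧ v₁ = true ∧ t₁ = true)
    (k₂₂ : ¬ d₂₂ → h₂ = true ∧ x₂ = true ∧ v₂ = true ∧ t₂ = true)
    (n₁₁ : A₀ → B₀ → ¬ d₁₁) (n₁₂ : A₀ → B₁ → ¬ d₁₂) (n₂₁ : A₁ → B₀ → ¬ d₂₁)
    (n₂₂ : A₁ → B₁ → ¬ d₂₂)
    (r₁₁ : (d₂₂ ∨ A₁ ∧ B₁) → d₂₁ → d₁₂ → ¬ d₁₁) (r₁₂ : (d₂₁ ∨ A₁ ∧ B₀) → d₂₂ → d₁₁ → ¬ d₁₂)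
    (r₂₁ : (d₁₂ ∨ A₀ ∧ B₁) → d₁₁ → d₂₂ → ¬ d₂₁) (r₂₂ : (d₁₁ ∨ A₀ ∧ B₀) → d₁₂ → d₂₁ → ¬ d₂₂) :
    ((l₁ = true ∧ l₂ = true ∧ x₁ = true ∧ x₂ = true) ∧
      (b₁ = true ∧ b₂ = true ∧ t₁ = true ∧ t₂ = true) ∧
      (h₁ = true ∧ h₂ = true ∧ v₁ = true ∧ v₂ = true)) ∨
    (A₀ ∧ ¬ B₀ ∧ ¬ B₁ ∧ b₁ = false ∧ b₂ = false ∧ h₁ = false ∧ v₁ = true ∧ v₂ = true) ∨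
    (A₁ ∧ ¬ B₀ ∧ ¬ B₁ ∧ t₁ = false ∧ t₂ = false ∧ h₂ = false ∧ v₁ = true ∧ v₂ = true) ∨
    (B₀ ∧ ¬ A₀ ∧ ¬ A₁ ∧ l₁ = false ∧ l₂ = false ∧ v₁ = false ∧ h₁ = true ∧ h₂ = true) ∨
    (B₁ ∧ ¬ A₀ ∧ ¬ A₁ ∧ x₁ = false ∧ x₂ = false ∧ v₂ = false ∧ h₁ = true ∧ h₂ = true) := by
  -- `A₀`, `A₁`, `B₀`, `B₁` say that the block touches the bottom, top, left or right edge of the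
  -- board. If all outer sides are met, parity makes the four inner sides equal, and four unmet ones
  -- give a forbidden rectangle. With an unmet pair along one edge, parity leaves the edge arc or
  -- again a rectangle. In a corner block the corner tile is a crossing and replaces one position of
  -- the rectangle.
  by_cases a0 : A₀ <;> by_cases a1 : A₁ <;> by_cases b0 : B₀ <;> by_cases b1 : B₁ <;>
    simp only [a0, a1, b0, b1, true_and, and_true, and_false, false_and, not_true_eq_false,
      not_false_eq_true, forall_const, IsEmpty.forall_iff, or_false, or_true,
      false_or] at * <;>
    cases h₁ <;> cases h₂ <;> cases v₁ <;> cases v₂ <;>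
    simp only [Bool.xor_false, Bool.xor_true, Bool.false_xor, Bool.true_xor] at * <;> grind

namespace SideGrid

variable {N : ℕ} (G : SideGrid N)

/-- Which of the left, right, bottom and top sides of a tile are met. -/
def sides (i j : ℕ) : Bool × Bool × Bool × Bool :=
  (G.H i j, G.H i (j + 1), G.V i j, G.V (i + 1) j)

/-- A strand runs along the edge of the board past two interior tiles that turn away from it. -/
def HasEdgeArc : Prop :=
  (∃ c, 1 ≤ c ∧ c + 1 ≤ N ∧
    G.sides 0 c = (true, true, false, false) ∧ G.sides 0 (c + 1) = (true, true, false, false) ∧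
    G.sides 1 c = (true, false, false, true) ∧ G.sides 1 (c + 1) = (false, true, false, true)) ∨
  (∃ c, 1 ≤ c ∧ c + 1 ≤ N ∧
    G.sides N c = (true, false, true, false) ∧ G.sides N (c + 1) = (false, true, true, false) ∧
    G.sides (N + 1) c = (true, true, false, false) ∧
    G.sides (N + 1) (c + 1) = (true, true, false, false)) ∨
  (∃ r, 1 ≤ r ∧ r + 1 ≤ N ∧
    G.sides r 0 = (false, false, true, true) ∧ G.sides r 1 = (false, true, true, false) ∧
    G.sides (r + 1) 0 = (false, false, true, true) ∧
    G.sides (r + 1) 1 = (false, true, false, true)) ∨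
  (∃ r, 1 ≤ r ∧ r + 1 ≤ N ∧
    G.sides r N = (true, false, true, false) ∧ G.sides r (N + 1) = (false, false, true, true) ∧
    G.sides (r + 1) N = (true, false, false, true) ∧
    G.sides (r + 1) (N + 1) = (false, false, true, true))

/-- The even cuts in both directions bound the block that contains the tile, which provides the
hypotheses of `block_sides`. -/
theorem sides_eq_or_hasEdgeArc {q : ℕ} (hN : N = 2 * q) (hD : G.D.card + 2 ≤ N) {i j : ℕ}
    (hi : 1 ≤ i) (hi' : i ≤ N) (hj : 1 ≤ j) (hj' : j ≤ N) :
    G.sides i j = (true, true, true, true) ∨ G.HasEdgeArc := by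
  have hN2 : 2 ≤ N := by omega
  -- Here one block would touch opposite edges, but all interior tiles are crossings.
  by_cases hq : q = 1
  · left
    have h0 : G.D = ∅ := by rw [← Finset.card_eq_zero]; omega
    have := G.crossing i j hi hi' hj hj' (by simp [h0])
    simp [sides, this]
  obtain ⟨a, ha, hia⟩ : ∃ a, a + 1 ≤ q ∧ (i = 2 * a + 1 ∨ i = 2 * a + 2) :=
    ⟨(i - 1) / 2, by omega, by omega⟩
  obtain ⟨b, hb, hjb⟩ : ∃ b, b + 1 ≤ q ∧ (j = 2 * b + 1 ∨ j = 2 * b + 2) :=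
    ⟨(j - 1) / 2, by omega, by omega⟩
  have hleft : ∀ i ≤ N + 1, b ≠ 0 → G.H i (2 * b + 1) = true := fun i hi hb0 =>
    G.H_even hN hN2 hD (by omega) (by omega) hi
  have hright : ∀ i ≤ N + 1, b + 1 ≠ q → G.H i (2 * b + 2 + 1) = true := fun i hi hb0 =>
    G.H_even hN hN2 hD (j := b + 1) (by omega) (by omega) hi
  have hbot : ∀ i ≤ N + 1, a ≠ 0 → G.V (2 * a + 1) i = true := fun i hi hb0 =>
    G.V_even hN hN2 hD (by omega) (by omega) hi
  have htop : ∀ i ≤ N + 1, a + 1 ≠ q → G.V (2 * a + 2 + 1) i = true := fun i hi hb0 =>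
    G.V_even hN hN2 hD (i := a + 1) (by omega) (by omega) hi
  have p11 := G.even_tile (2 * a + 1) (2 * b + 1) (by omega) (by omega)
  have p12 := G.even_tile (2 * a + 1) (2 * b + 2) (by omega) (by omega)
  have p21 := G.even_tile (2 * a + 2) (2 * b + 1) (by omega) (by omega)
  have p22 := G.even_tile (2 * a + 2) (2 * b + 2) (by omega) (by omega)
  have k11 := G.crossing (2 * a + 1) (2 * b + 1) (by omega) (by omega) (by omega) (by omega)
  have k12 := G.crossing (2 * a + 1) (2 * b + 2) (by omega) (by omega) (by omega) (by omega)
  have k21 := G.crossing (2 * a + 2) (2 * b + 1) (by omega) (by omega) (by omega) (by omega)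
  have k22 := G.crossing (2 * a + 2) (2 * b + 2) (by omega) (by omega) (by omega) (by omega)
  have hr : 2 * a + 1 ≠ 2 * a + 2 := by omega
  have hc : 2 * b + 1 ≠ 2 * b + 2 := by omega
  have r11 := G.rectangle_notMem hN hN2 hD hr hc
  have r12 := G.rectangle_notMem hN hN2 hD hr hc.symm
  have r21 := G.rectangle_notMem hN hN2 hD hr.symm hc
  have r22 := G.rectangle_notMem hN hN2 hD hr.symm hc.symm
  have n11 := G.corner_notMem hN hN2 hD (d := (2 * a + 1, 2 * b + 1))
  have n12 := G.corner_notMem hN hN2 hD (d := (2 * a + 1, 2 * b + 2))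
  have n21 := G.corner_notMem hN hN2 hD (d := (2 * a + 2, 2 * b + 1))
  have n22 := G.corner_notMem hN hN2 hD (d := (2 * a + 2, 2 * b + 2))
  have c11 : a = 0 → b = 0 → (2 * a + 1, 2 * b + 1) ∈ corners N := fun h h' =>
    mem_corners.2 ⟨Or.inl (by simp [h]), Or.inl (by simp [h'])⟩
  have c12 : a = 0 → b + 1 = q → (2 * a + 1, 2 * b + 2) ∈ corners N := fun h h' =>
    mem_corners.2 ⟨Or.inl (by simp [h]), Or.inr (by simp only; omega)⟩
  have c21 : a + 1 = q → b = 0 → (2 * a + 2, 2 * b + 1) ∈ corners N := fun h h' =>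
    mem_corners.2 ⟨Or.inr (by simp only; omega), Or.inl (by simp [h'])⟩
  have c22 : a + 1 = q → b + 1 = q → (2 * a + 2, 2 * b + 2) ∈ corners N := fun h h' =>
    mem_corners.2 ⟨Or.inr (by simp only; omega), Or.inr (by simp only; omega)⟩
  have hq0 : ¬ (a = 0 ∧ a + 1 = q) := by omega
  have hq1 : ¬ (b = 0 ∧ b + 1 = q) := by omega
  have edge0 : b ≠ 0 → b + 1 ≠ q → G.H 0 (2 * b + 1) = true ∧ G.H 0 (2 * b + 2 + 1) = true :=
    fun h h' => ⟨hleft 0 (by omega) h, hright 0 (by omega) h'⟩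
  have edge1 : b ≠ 0 → b + 1 ≠ q →
      G.H (N + 1) (2 * b + 1) = true ∧ G.H (N + 1) (2 * b + 2 + 1) = true :=
    fun h h' => ⟨hleft _ (by omega) h, hright _ (by omega) h'⟩
  have edge2 : a ≠ 0 → a + 1 ≠ q → G.V (2 * a + 1) 0 = true ∧ G.V (2 * a + 2 + 1) 0 = true :=
    fun h h' => ⟨hbot 0 (by omega) h, htop 0 (by omega) h'⟩
  have edge3 : a ≠ 0 → a + 1 ≠ q →
      G.V (2 * a + 1) (N + 1) = true ∧ G.V (2 * a + 2 + 1) (N + 1) = true :=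
    fun h h' => ⟨hbot _ (by omega) h, htop _ (by omega) h'⟩
  have z0 := G.H_zero
  have z1 := G.H_end
  have z2 := G.V_zero
  have z3 := G.V_end
  have u01 := G.even_tile 0 (2 * b + 1) (by omega) (by omega)
  have u02 := G.even_tile 0 (2 * b + 2) (by omega) (by omega)
  have u11 := G.even_tile (N + 1) (2 * b + 1) (by omega) (by omega)
  have u12 := G.even_tile (N + 1) (2 * b + 2) (by omega) (by omega)
  have u21 := G.even_tile (2 * a + 1) 0 (by omega) (by omega)
  have u22 := G.even_tile (2 * a + 2) 0 (by omega) (by omega)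
  have u31 := G.even_tile (2 * a + 1) (N + 1) (by omega) (by omega)
  have u32 := G.even_tile (2 * a + 2) (N + 1) (by omega) (by omega)
  have key := block_sides hq0 hq1
    (fun h => ⟨hleft (2 * a + 1) (by omega) h, hleft (2 * a + 2) (by omega) h⟩)
    (fun h => ⟨hright (2 * a + 1) (by omega) h, hright (2 * a + 2) (by omega) h⟩)
    (fun h => ⟨hbot (2 * b + 1) (by omega) h, hbot (2 * b + 2) (by omega) h⟩)
    (fun h => ⟨htop (2 * b + 1) (by omega) h, htop (2 * b + 2) (by omega) h⟩)
    p11 p12 p21 p22 k11 k12 k21 k22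
    (fun h h' => n11 (c11 h h')) (fun h h' => n12 (c12 h h'))
    (fun h h' => n21 (c21 h h')) (fun h h' => n22 (c22 h h'))
    -- `rectangle_notMem` is indexed here by the position that may be a corner, `block_sides` by the
    -- excluded one, which is diagonally opposite.
    (fun h h1 h2 => r22 (h.imp_right fun h => c22 h.1 h.2) h1 h2)
    (fun h h1 h2 => r21 (h.imp_right fun h => c21 h.1 h.2) h1 h2)
    (fun h h1 h2 => r12 (h.imp_right fun h => c12 h.1 h.2) h1 h2)
    (fun h h1 h2 => r11 (h.imp_right fun h => c11 h.1 h.2) h1 h2)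
  rcases key with ⟨h1, h2, h3⟩ | ⟨ha0, hb0, hb1, hs⟩ | ⟨ha0, hb0, hb1, hs⟩ |
      ⟨hb0, ha0, ha1, hs⟩ | ⟨hb0, ha0, ha1, hs⟩
  · left
    rcases hia with rfl | rfl <;> rcases hjb with rfl | rfl <;> simp [sides, h1, h2, h3]
  · right; left
    subst ha0
    obtain ⟨e1, e2⟩ := edge0 hb0 hb1
    have e3 := hleft 1 (by omega) hb0
    have e4 := hright 1 (by omega) hb1
    refine ⟨2 * b + 1, by omega, by omega, ?_⟩
    simp_all [sides]
  · right; right; left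
    obtain ⟨e1, e2⟩ := edge1 hb0 hb1
    have e3 := hleft N (by omega) hb0
    have e4 := hright N (by omega) hb1
    obtain rfl : N = 2 * a + 2 := by omega
    refine ⟨2 * b + 1, by omega, by omega, ?_⟩
    simp_all [sides]
  · right; right; right; left
    subst hb0
    obtain ⟨e1, e2⟩ := edge2 ha0 ha1
    have e3 := hbot 1 (by omega) ha0
    have e4 := htop 1 (by omega) ha1
    refine ⟨2 * a + 1, by omega, by omega, ?_⟩
    simp_all [sides]
  · right; right; right; right
    obtain ⟨e1, e2⟩ := edge3 ha0 ha1
    have e3 := hbot N (by omega) ha0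
    have e4 := htop N (by omega) ha1
    obtain rfl : N = 2 * b + 2 := by omega
    refine ⟨2 * a + 1, by omega, by omega, ?_⟩
    simp_all [sides]

end SideGrid

/-! ### From the link in space to the side pattern -/

namespace KnotMosaic

instance (t : Tile) (s : Side) : Decidable (t.Meets s) := by
  unfold Tile.Meets; infer_instance

/-- The strands of the tile `t`, placed in row `i` and column `j`. -/
noncomputable def tileSet (i j : ℕ) (t : Tile) : Set (Fin 3 → ℝ) :=
  ⋃ c ∈ t.strands, strandSet i j c

theorem mem_tileSet {i j : ℕ} {t : Tile} {x : Fin 3 → ℝ} :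
    x ∈ tileSet i j t ↔ ∃ c ∈ t.strands, x ∈ strandSet i j c := by
  simp [tileSet]

theorem isClosed_segment_pi (a b : Fin 3 → ℝ) : IsClosed (segment ℝ a b) := by
  rw [← convexHull_pair]
  exact ((Set.toFinite {a, b}).isCompact_convexHull ℝ).isClosed

theorem isClosed_strandSet (i j : ℕ) (c : Side × Side × ℕ) : IsClosed (strandSet i j c) :=
  (isClosed_segment_pi _ _).union (isClosed_segment_pi _ _)

theorem isClosed_tileSet (i j : ℕ) (t : Tile) : IsClosed (tileSet i j t) :=
  (List.finite_toSet t.strands).isClosed_biUnion fun c _ => isClosed_strandSet i j c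

namespace Mosaic

variable {n : ℕ} (M : Mosaic n)

/-- The tile in a given row and column, blank outside the board. -/
def tileAt (i j : ℕ) : Tile :=
  if h : i < n ∧ j < n then M.tile ⟨i, h.1⟩ ⟨j, h.2⟩ else .t1

theorem tileAt_val (i j : Fin n) : M.tileAt i j = M.tile i j := by
  simp [tileAt]

theorem tileAt_of_not {i j : ℕ} (h : ¬ (i < n ∧ j < n)) : M.tileAt i j = .t1 := by
  simp [tileAt, h]

theorem tileAt_ne (i j : ℕ) : M.tileAt i j ≠ .t0 := by
  unfold tileAt
  split_ifs
  · exact M.tile_ne _ _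
  · decide

theorem mem_realization {x : Fin 3 → ℝ} :
    x ∈ M.realization ↔ ∃ i j, i < n ∧ j < n ∧ x ∈ tileSet i j (M.tileAt i j) := by
  simp only [realization, Set.mem_iUnion, mem_tileSet]
  constructor
  · rintro ⟨i, j, c, hc, hx⟩
    exact ⟨i, j, i.2, j.2, c, by rwa [tileAt_val], hx⟩
  · rintro ⟨i, j, hi, hj, c, hc, hx⟩
    refine ⟨⟨i, hi⟩, ⟨j, hj⟩, c, ?_, hx⟩
    have := M.tileAt_val ⟨i, hi⟩ ⟨j, hj⟩
    rwa [← this]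

/-- With blank tiles beyond the board, the conditions at the right and top edges become instances of
matching. -/
theorem suitablyConnected_iff : M.SuitablyConnected ↔
    (∀ i j, (M.tileAt i j).Meets .right ↔ (M.tileAt i (j + 1)).Meets .left) ∧
    (∀ i j, (M.tileAt i j).Meets .top ↔ (M.tileAt (i + 1) j).Meets .bottom) ∧
    (∀ i, ¬ (M.tileAt i 0).Meets .left) ∧ ∀ j, ¬ (M.tileAt 0 j).Meets .bottom := by
  have blank : ∀ s, ¬ Tile.t1.Meets s := by intro s; cases s <;> decide
  constructor
  · intro h
    refine ⟨fun i j => ?_, fun i j => ?_, fun i => ?_, fun j => ?_⟩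
    · by_cases h1 : i < n ∧ j < n
      · by_cases h2 : j + 1 < n
        · have := h.horizontal ⟨i, h1.1⟩ ⟨j, h1.2⟩ ⟨j + 1, h2⟩ rfl
          rwa [← tileAt_val, ← tileAt_val] at this
        · have := h.right_end ⟨i, h1.1⟩ ⟨j, h1.2⟩ (by simp only; omega)
          rw [← tileAt_val] at this
          rw [M.tileAt_of_not (j := j + 1) (by omega)]
          exact iff_of_false this (blank _)
      · rw [M.tileAt_of_not h1, M.tileAt_of_not (j := j + 1) (by omega)]
        exact iff_of_false (blank _) (blank _)
    · by_cases h1 : i < n ∧ j < n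
      · by_cases h2 : i + 1 < n
        · have := h.vertical ⟨i, h1.1⟩ ⟨i + 1, h2⟩ ⟨j, h1.2⟩ rfl
          rwa [← tileAt_val, ← tileAt_val] at this
        · have := h.top_end ⟨i, h1.1⟩ ⟨j, h1.2⟩ (by simp only; omega)
          rw [← tileAt_val] at this
          rw [M.tileAt_of_not (i := i + 1) (by omega)]
          exact iff_of_false this (blank _)
      · rw [M.tileAt_of_not h1, M.tileAt_of_not (i := i + 1) (by omega)]
        exact iff_of_false (blank _) (blank _)
    · by_cases h1 : i < n ∧ 0 < n
      · have := h.left_end ⟨i, h1.1⟩ ⟨0, h1.2⟩ rfl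
        rwa [← tileAt_val] at this
      · rw [M.tileAt_of_not h1]
        exact blank _
    · by_cases h1 : 0 < n ∧ j < n
      · have := h.bottom_end ⟨0, h1.1⟩ ⟨j, h1.2⟩ rfl
        rwa [← tileAt_val] at this
      · rw [M.tileAt_of_not h1]
        exact blank _
  · rintro ⟨h1, h2, h3, h4⟩
    refine ⟨fun i j j' hj => ?_, fun i i' j hi => ?_, fun i j hj => ?_, fun i j hj => ?_,
      fun i j hi => ?_, fun i j hi => ?_⟩
    · rw [← tileAt_val, ← tileAt_val, hj]
      exact h1 i j
    · rw [← tileAt_val, ← tileAt_val, hi]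
      exact h2 i j
    · rw [← tileAt_val, hj]
      exact h3 i
    · rw [← tileAt_val, h1, M.tileAt_of_not (by omega)]
      exact blank _
    · rw [← tileAt_val, hi]
      exact h4 j
    · rw [← tileAt_val, h2, M.tileAt_of_not (by omega)]
      exact blank _

end Mosaic

/-- Strands of different tiles can thus meet only at side midpoints. -/
theorem strandSet_cases {i j : ℕ} {s s' : Side} {h : ℕ} (hs : s ≠ s') {x : Fin 3 → ℝ}
    (hx : x ∈ strandSet i j (s, s', h)) :
    x = sidePoint i j s ∨ x = sidePoint i j s' ∨
      (2 * (j : ℝ) < x 0 ∧ x 0 < 2 * (j : ℝ) + 2) ∧ 2 * (i : ℝ) < x 1 ∧ x 1 < 2 * (i : ℝ) + 2 := by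
  rcases hx with hx | hx
  · obtain ⟨a, b, ha, hb, hab, rfl⟩ := hx
    rcases hb.eq_or_lt with rfl | hb
    · left
      simp [show a = 1 by linarith]
    · right; right
      obtain rfl : a = 1 - b := by linarith
      cases s <;> cases s' <;> first
        | exact absurd rfl hs
        | (simp [strandMid, midpoint_eq_smul_add, sidePoint]
           refine ⟨⟨?_, ?_⟩, ?_, ?_⟩ <;> linarith)
  · obtain ⟨a, b, ha, hb, hab, rfl⟩ := hx
    rcases ha.eq_or_lt with rfl | ha
    · right; left
      simp [show b = 1 by linarith]
    · right; right
      obtain rfl : b = 1 - a := by linarith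
      cases s <;> cases s' <;> first
        | exact absurd rfl hs
        | (simp [strandMid, midpoint_eq_smul_add, sidePoint]
           refine ⟨⟨?_, ?_⟩, ?_, ?_⟩ <;> linarith)

theorem strand_ne {t : Tile} {c : Side × Side × ℕ} (hc : c ∈ t.strands) : c.1 ≠ c.2.1 := by
  cases t <;> revert c <;> decide

theorem mem_segment_coord {p q x : Fin 3 → ℝ} (hx : x ∈ segment ℝ p q) :
    ∃ b : ℝ, 0 ≤ b ∧ b ≤ 1 ∧ ∀ k, x k = (1 - b) * p k + b * q k := by
  obtain ⟨a, b, ha, hb, hab, rfl⟩ := hx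
  obtain rfl : a = 1 - b := by linarith
  exact ⟨b, hb, by linarith, fun k => by simp⟩

/-- Different strands of a tile are disjoint. -/
theorem strandSet_disjoint {i j : ℕ} {t : Tile} {c c' : Side × Side × ℕ} (hc : c ∈ t.strands)
    (hc' : c' ∈ t.strands) {x : Fin 3 → ℝ} (hx : x ∈ strandSet i j c)
    (hx' : x ∈ strandSet i j c') : c = c' := by
  have h4a : x ∈ strandSet i j (.left, .bottom, 0) → x ∈ strandSet i j (.right, .top, 0) →
      False := by
    rintro (hx | hx) (hy | hy) <;>
    · obtain ⟨a, ha, ha', ea⟩ := mem_segment_coord hx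
      obtain ⟨b, hb, hb', eb⟩ := mem_segment_coord hy
      have e0 := (ea 0).symm.trans (eb 0)
      have e1 := (ea 1).symm.trans (eb 1)
      have e2 := (ea 2).symm.trans (eb 2)
      simp [strandMid, midpoint_eq_smul_add, sidePoint] at e0 e1 e2
      linarith
  have h4b : x ∈ strandSet i j (.bottom, .right, 0) → x ∈ strandSet i j (.top, .left, 0) →
      False := by
    rintro (hx | hx) (hy | hy) <;>
    · obtain ⟨a, ha, ha', ea⟩ := mem_segment_coord hx
      obtain ⟨b, hb, hb', eb⟩ := mem_segment_coord hy
      have e0 := (ea 0).symm.trans (eb 0)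
      have e1 := (ea 1).symm.trans (eb 1)
      have e2 := (ea 2).symm.trans (eb 2)
      simp [strandMid, midpoint_eq_smul_add, sidePoint] at e0 e1 e2
      linarith
  have h5a : x ∈ strandSet i j (.left, .right, 1) → x ∈ strandSet i j (.bottom, .top, 0) →
      False := by
    rintro (hx | hx) (hy | hy) <;>
    · obtain ⟨a, ha, ha', ea⟩ := mem_segment_coord hx
      obtain ⟨b, hb, hb', eb⟩ := mem_segment_coord hy
      have e0 := (ea 0).symm.trans (eb 0)
      have e1 := (ea 1).symm.trans (eb 1)
      have e2 := (ea 2).symm.trans (eb 2)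
      simp [strandMid, midpoint_eq_smul_add, sidePoint] at e0 e1 e2
      linarith
  have h5b : x ∈ strandSet i j (.left, .right, 0) → x ∈ strandSet i j (.bottom, .top, 1) →
      False := by
    rintro (hx | hx) (hy | hy) <;>
    · obtain ⟨a, ha, ha', ea⟩ := mem_segment_coord hx
      obtain ⟨b, hb, hb', eb⟩ := mem_segment_coord hy
      have e0 := (ea 0).symm.trans (eb 0)
      have e1 := (ea 1).symm.trans (eb 1)
      have e2 := (ea 2).symm.trans (eb 2)
      simp [strandMid, midpoint_eq_smul_add, sidePoint] at e0 e1 e2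
      linarith
  cases t <;> simp only [Tile.strands, List.mem_cons, List.not_mem_nil, or_false] at hc hc'
  all_goals first
    | exact hc.trans hc'.symm
    | (rcases hc with rfl | rfl <;> rcases hc' with rfl | rfl <;> first | rfl | (exfalso; tauto))

theorem natCast_strict {a b : ℕ} (h1 : 2 * (a : ℝ) < 2 * (b : ℝ) + 2)
    (h2 : 2 * (b : ℝ) < 2 * (a : ℝ) + 2) : a = b := by
  have h1' : 2 * a < 2 * b + 2 := by exact_mod_cast h1
  have h2' : 2 * b < 2 * a + 2 := by exact_mod_cast h2
  omega

/-- A side midpoint of one tile does not lie in the interior of another tile. -/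
theorem sidePoint_not_inside {i j i' j' : ℕ} {s : Side}
    (h0 : 2 * (j' : ℝ) < sidePoint i j s 0) (h0' : sidePoint i j s 0 < 2 * (j' : ℝ) + 2)
    (h1 : 2 * (i' : ℝ) < sidePoint i j s 1) (h1' : sidePoint i j s 1 < 2 * (i' : ℝ) + 2) :
    False := by
  cases s <;> simp [sidePoint] at h0 h0' h1 h1' <;> norm_cast at h0 h0' h1 h1' <;> omega

/-- A labelling of the sides of the tiles of a board in which the common side of two adjacent
tiles has one label. -/
def sideLabel {α : Type*} (gH gV : ℕ → ℕ → α) (i j : ℕ) : Side → α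
  | .left => gH i j
  | .right => gH i (j + 1)
  | .bottom => gV i j
  | .top => gV (i + 1) j

theorem sideLabel_eq_of_sidePoint_eq {α : Type*} (gH gV : ℕ → ℕ → α) {i j i' j' : ℕ}
    {s s' : Side} (h : sidePoint i j s = sidePoint i' j' s') :
    sideLabel gH gV i j s = sideLabel gH gV i' j' s' := by
  have h0 := congrFun h 0
  have h1 := congrFun h 1
  cases s <;> cases s' <;> simp [sidePoint] at h0 h1 <;> norm_cast at h0 h1 <;>
    first
    | (exfalso; omega)
    | (obtain rfl : i = i' := by omega
       obtain rfl : j = j' := by omega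
       rfl)
    | (obtain rfl : i = i' := by omega
       obtain rfl : j = j' + 1 := by omega
       rfl)
    | (obtain rfl : i = i' := by omega
       obtain rfl : j' = j + 1 := by omega
       rfl)
    | (obtain rfl : i = i' + 1 := by omega
       obtain rfl : j = j' := by omega
       rfl)
    | (obtain rfl : i' = i + 1 := by omega
       obtain rfl : j = j' := by omega
       rfl)

theorem even_meets (t : Tile) : (decide (t.Meets .left) ^^ decide (t.Meets .right) ^^
    decide (t.Meets .bottom) ^^ decide (t.Meets .top)) = false := by
  cases t <;> decide

namespace Mosaic

variable {n : ℕ} (M : Mosaic n)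

/-- Strands that meet have the same label. -/
theorem label_eq_of_mem {α : Type*} {gH gV : ℕ → ℕ → α}
    (hg : ∀ i j, ∀ c ∈ (M.tileAt i j).strands,
      sideLabel gH gV i j c.1 = sideLabel gH gV i j c.2.1)
    {i j i' j' : ℕ} {c c' : Side × Side × ℕ} (hc : c ∈ (M.tileAt i j).strands)
    (hc' : c' ∈ (M.tileAt i' j').strands) {x : Fin 3 → ℝ} (hx : x ∈ strandSet i j c)
    (hx' : x ∈ strandSet i' j' c') : sideLabel gH gV i j c.1 = sideLabel gH gV i' j' c'.1 := by
  have side : ∀ {i j : ℕ} {c : Side × Side × ℕ}, c ∈ (M.tileAt i j).strands →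
      x ∈ strandSet i j c →
      (∃ s, x = sidePoint i j s ∧ sideLabel gH gV i j c.1 = sideLabel gH gV i j s) ∨
      (2 * (j : ℝ) < x 0 ∧ x 0 < 2 * (j : ℝ) + 2) ∧ 2 * (i : ℝ) < x 1 ∧
        x 1 < 2 * (i : ℝ) + 2 := by
    intro i j c hc hx
    rcases strandSet_cases (strand_ne hc) hx with h | h | h
    · exact Or.inl ⟨_, h, rfl⟩
    · exact Or.inl ⟨_, h, hg i j c hc⟩
    · exact Or.inr h
  rcases side hc hx with ⟨s, hs, hl⟩ | h <;> rcases side hc' hx' with ⟨s', hs', hl'⟩ | h'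
  · rw [hl, hl']
    exact sideLabel_eq_of_sidePoint_eq gH gV (hs.symm.trans hs')
  · subst hs
    exact (sidePoint_not_inside h'.1.1 h'.1.2 h'.2.1 h'.2.2).elim
  · subst hs'
    exact (sidePoint_not_inside h.1.1 h.1.2 h.2.1 h.2.2).elim
  · obtain rfl : j = j' := natCast_strict (by linarith) (by linarith)
    obtain rfl : i = i' := natCast_strict (by linarith) (by linarith)
    rw [strandSet_disjoint hc hc' hx hx']

/-- The part of the realization that consists of the strands satisfying a given condition. -/
def strandUnion (P : ℕ → ℕ → Side × Side × ℕ → Prop) : Set (Fin 3 → ℝ) :=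
  ⋃ i ∈ Set.Iio n, ⋃ j ∈ Set.Iio n, ⋃ c ∈ {c | c ∈ (M.tileAt i j).strands ∧ P i j c},
    strandSet i j c

theorem mem_strandUnion {P : ℕ → ℕ → Side × Side × ℕ → Prop} {x : Fin 3 → ℝ} :
    x ∈ M.strandUnion P ↔
      ∃ i j c, i < n ∧ j < n ∧ c ∈ (M.tileAt i j).strands ∧ P i j c ∧ x ∈ strandSet i j c := by
  simp only [strandUnion, Set.mem_iUnion, Set.mem_Iio, Set.mem_ofPred_eq]
  constructor
  · rintro ⟨i, hi, j, hj, c, hc, hx⟩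
    exact ⟨i, j, c, hi, hj, hc.1, hc.2, hx⟩
  · rintro ⟨i, j, c, hi, hj, hc, hP, hx⟩
    exact ⟨i, hi, j, hj, c, ⟨hc, hP⟩, hx⟩

theorem isClosed_strandUnion (P : ℕ → ℕ → Side × Side × ℕ → Prop) :
    IsClosed (M.strandUnion P) :=
  (Set.finite_Iio n).isClosed_biUnion fun i _ => (Set.finite_Iio n).isClosed_biUnion fun j _ =>
    ((List.finite_toSet (M.tileAt i j).strands).subset fun _ h => h.1).isClosed_biUnion
      fun c _ => isClosed_strandSet i j c

/-- On a connected mosaic, labels that are constant along the strands are constant. -/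
theorem label_const {α : Type*} (hM : IsPreconnected M.realization) {gH gV : ℕ → ℕ → α}
    (hg : ∀ i j, ∀ c ∈ (M.tileAt i j).strands,
      sideLabel gH gV i j c.1 = sideLabel gH gV i j c.2.1)
    {i j i' j' : ℕ} (hi : i < n) (hj : j < n) (hi' : i' < n) (hj' : j' < n)
    {c c' : Side × Side × ℕ} (hc : c ∈ (M.tileAt i j).strands)
    (hc' : c' ∈ (M.tileAt i' j').strands) :
    sideLabel gH gV i j c.1 = sideLabel gH gV i' j' c'.1 := by
  set a := sideLabel gH gV i j c.1 with ha
  by_contra hne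
  have hpt : ∀ i j c, sidePoint i j c.1 ∈ strandSet i j c := fun i j c =>
    Or.inl (left_mem_segment ℝ _ _)
  have hmem : ∀ {i j c}, i < n → j < n → c ∈ (M.tileAt i j).strands →
      sidePoint i j c.1 ∈ M.realization := fun {i j c} hi hj hc =>
    M.mem_realization.2 ⟨i, j, hi, hj, mem_tileSet.2 ⟨c, hc, hpt i j c⟩⟩
  -- The strands with label `a` and those with another label form two closed sets covering the link.
  -- Connectedness yields a common point, and strands through it share their label.
  obtain ⟨x, -, hx1, hx2⟩ := isPreconnected_closed_iff.1 hM _ _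
    (M.isClosed_strandUnion fun i j c => sideLabel gH gV i j c.1 = a)
    (M.isClosed_strandUnion fun i j c => sideLabel gH gV i j c.1 ≠ a)
    (by
      intro x hx
      obtain ⟨i, j, hi, hj, hx⟩ := M.mem_realization.1 hx
      obtain ⟨c, hc, hx⟩ := mem_tileSet.1 hx
      by_cases h : sideLabel gH gV i j c.1 = a
      · exact Or.inl (M.mem_strandUnion.2 ⟨i, j, c, hi, hj, hc, h, hx⟩)
      · exact Or.inr (M.mem_strandUnion.2 ⟨i, j, c, hi, hj, hc, h, hx⟩))
    ⟨_, hmem hi hj hc, M.mem_strandUnion.2 ⟨i, j, c, hi, hj, hc, rfl, hpt i j c⟩⟩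
    ⟨_, hmem hi' hj' hc',
      M.mem_strandUnion.2 ⟨i', j', c', hi', hj', hc', fun h => hne h.symm, hpt i' j' c'⟩⟩
  obtain ⟨_, _, _, _, _, hc1, hP1, hx1⟩ := M.mem_strandUnion.1 hx1
  obtain ⟨_, _, _, _, _, hc2, hP2, hx2⟩ := M.mem_strandUnion.1 hx2
  exact hP2 ((M.label_eq_of_mem hg hc1 hc2 hx1 hx2).symm.trans hP1)

/-- The interior positions, counted from `0` on the whole board, that are not crossings. -/
def nonCrossings (N : ℕ) (t : ℕ → ℕ → Tile) : Finset (ℕ × ℕ) :=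
  (Finset.Icc 1 N ×ˢ Finset.Icc 1 N).filter fun p => t p.1 p.2 ≠ .t5a ∧ t p.1 p.2 ≠ .t5b

theorem mem_nonCrossings {N : ℕ} {t : ℕ → ℕ → Tile} {i j : ℕ} :
    (i, j) ∈ nonCrossings N t ↔
      ((1 ≤ i ∧ i ≤ N) ∧ 1 ≤ j ∧ j ≤ N) ∧ t i j ≠ .t5a ∧ t i j ≠ .t5b := by
  simp [nonCrossings]

/-- The sides met by a knot mosaic. -/
def sideGrid {N : ℕ} (M : Mosaic (N + 2)) (hM : M.IsKnotMosaic) : SideGrid N where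
  H i j := decide ((M.tileAt i j).Meets .left)
  V i j := decide ((M.tileAt i j).Meets .bottom)
  D := nonCrossings N M.tileAt
  even_tile i j _ _ := by
    obtain ⟨h1, h2, -, -⟩ := M.suitablyConnected_iff.1 hM.1
    have e1 : decide ((M.tileAt i (j + 1)).Meets .left) = decide ((M.tileAt i j).Meets .right) :=
      decide_eq_decide.2 (h1 i j).symm
    have e2 : decide ((M.tileAt (i + 1) j).Meets .bottom) = decide ((M.tileAt i j).Meets .top) :=
      decide_eq_decide.2 (h2 i j).symm
    rw [e1, e2]
    exact even_meets _
  H_zero i := decide_eq_false ((M.suitablyConnected_iff.1 hM.1).2.2.1 i)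
  H_end i := by
    rw [M.tileAt_of_not (by omega)]
    decide
  V_zero j := decide_eq_false ((M.suitablyConnected_iff.1 hM.1).2.2.2 j)
  V_end j := by
    rw [M.tileAt_of_not (by omega)]
    decide
  crossing i j hi hi' hj hj' h := by
    obtain ⟨h1, h2, -, -⟩ := M.suitablyConnected_iff.1 hM.1
    rw [mem_nonCrossings] at h
    simp only [decide_eq_true_eq, ← h1 i j, ← h2 i j]
    have : M.tileAt i j = .t5a ∨ M.tileAt i j = .t5b := by tauto
    rcases this with h | h <;> rw [h] <;> decide
  connected gH gV hcr htile := by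
    obtain ⟨h1, h2, -, -⟩ := M.suitablyConnected_iff.1 hM.1
    have hg : ∀ i j, ∀ c ∈ (M.tileAt i j).strands,
        sideLabel gH gV i j c.1 = sideLabel gH gV i j c.2.1 := by
      intro i j c hc
      by_cases hij : i < N + 2 ∧ j < N + 2
      · by_cases hin : 1 ≤ i ∧ i ≤ N ∧ 1 ≤ j ∧ j ≤ N ∧ (i, j) ∉ nonCrossings N M.tileAt
        · obtain ⟨e1, e2⟩ := hcr i j hin.1 hin.2.1 hin.2.2.1 hin.2.2.2.1 hin.2.2.2.2
          have h := hin.2.2.2.2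
          rw [mem_nonCrossings] at h
          have : M.tileAt i j = .t5a ∨ M.tileAt i j = .t5b := by tauto
          rcases this with h | h <;> rw [h] at hc <;>
            simp only [Tile.strands, List.mem_cons, List.not_mem_nil, or_false] at hc <;>
            rcases hc with rfl | rfl <;> assumption
        · obtain ⟨a, e1, e2, e3, e4⟩ := htile i j (by omega) (by omega) hin
          simp only [decide_eq_true_eq, ← h1 i j, ← h2 i j] at e1 e2 e3 e4
          have key : ∀ s, (M.tileAt i j).Meets s → sideLabel gH gV i j s = a := by
            intro s
            cases s <;> assumption
          rw [key _ ⟨c, hc, Or.inl rfl⟩, key _ ⟨c, hc, Or.inr rfl⟩]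
      · rw [M.tileAt_of_not hij] at hc
        simp [Tile.strands] at hc
    -- The link is nonempty, so some strand supplies the common value.
    obtain ⟨x, hx⟩ := hM.2.nonempty
    obtain ⟨i₀, j₀, hi₀, hj₀, hx⟩ := M.mem_realization.1 hx
    obtain ⟨c₀, hc₀, -⟩ := mem_tileSet.1 hx
    have key : ∀ i j s, i < N + 2 → j < N + 2 → (M.tileAt i j).Meets s →
        sideLabel gH gV i j s = sideLabel gH gV i₀ j₀ c₀.1 := by
      rintro i j s hi hj ⟨c, hc, rfl | rfl⟩
      · exact M.label_const hM.2.isPreconnected hg hi hj hi₀ hj₀ hc hc₀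
      · rw [← hg i j c hc]
        exact M.label_const hM.2.isPreconnected hg hi hj hi₀ hj₀ hc hc₀
    exact ⟨_, fun i j hi hj =>
      ⟨fun h => key i j .left (by omega) (by omega) (of_decide_eq_true h),
        fun h => key i j .bottom (by omega) (by omega) (of_decide_eq_true h)⟩⟩

end Mosaic

/-! ### The triangle behind a push -/

/-- A point in the plane of height `0`. -/
noncomputable def pt (x y : ℝ) : Fin 3 → ℝ := ![x, y, 0]

theorem segment_union_segment_midpoint {E : Type*} [AddCommGroup E] [Module ℝ E] (p q : E) :
    segment ℝ p (midpoint ℝ p q) ∪ segment ℝ (midpoint ℝ p q) q = segment ℝ p q := by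
  apply Set.Subset.antisymm
  · refine Set.union_subset ?_ ?_
    · exact (convex_segment p q).segment_subset (left_mem_segment ℝ p q)
        (midpoint_mem_segment p q)
    · exact (convex_segment p q).segment_subset (midpoint_mem_segment p q)
        (right_mem_segment ℝ p q)
  · rintro x ⟨a, b, ha, hb, hab, rfl⟩
    rw [midpoint_eq_smul_add]
    rcases le_total b a with h | h
    · left
      refine ⟨1 - 2 * b, 2 * b, by linarith, by linarith, by ring, ?_⟩
      obtain rfl : a = 1 - b := by linarith
      simp only [invOf_eq_inv]
      module
    · right
      refine ⟨2 * a, 1 - 2 * a, by linarith, by linarith, by ring, ?_⟩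
      obtain rfl : b = 1 - a := by linarith
      simp only [invOf_eq_inv]
      module

theorem pt_segment_union {x y x' y' x'' y'' : ℝ} (hx : 2 * x' = x + x'')
    (hy : 2 * y' = y + y'') :
    segment ℝ (pt x y) (pt x'' y'') =
      segment ℝ (pt x y) (pt x' y') ∪ segment ℝ (pt x' y') (pt x'' y'') := by
  have : pt x' y' = midpoint ℝ (pt x y) (pt x'' y'') := by
    ext k
    fin_cases k <;> simp [pt, midpoint_eq_smul_add] <;> linarith
  rw [this, segment_union_segment_midpoint]

theorem strandSet_zero (i j : ℕ) (s s' : Side) :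
    strandSet i j (s, s', 0) = segment ℝ (sidePoint i j s) (sidePoint i j s') := by
  have : (![0, 0, ((0 : ℕ) : ℝ)] : Fin 3 → ℝ) = 0 := by
    ext k
    fin_cases k <;> simp
  simp only [strandSet, strandMid, this, add_zero, segment_union_segment_midpoint]

/-- The coordinates of the side midpoints in a block of four tiles. -/
theorem block_sidePoint (r c : ℕ) :
    (sidePoint r c .left = pt (2 * c) (2 * r + 1) ∧
      sidePoint r c .right = pt (2 * c + 2) (2 * r + 1) ∧
      sidePoint r c .bottom = pt (2 * c + 1) (2 * r) ∧
      sidePoint r c .top = pt (2 * c + 1) (2 * r + 2)) ∧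
    (sidePoint r (c + 1) .left = pt (2 * c + 2) (2 * r + 1) ∧
      sidePoint r (c + 1) .right = pt (2 * c + 4) (2 * r + 1) ∧
      sidePoint r (c + 1) .bottom = pt (2 * c + 3) (2 * r) ∧
      sidePoint r (c + 1) .top = pt (2 * c + 3) (2 * r + 2)) ∧
    (sidePoint (r + 1) c .left = pt (2 * c) (2 * r + 3) ∧
      sidePoint (r + 1) c .right = pt (2 * c + 2) (2 * r + 3) ∧
      sidePoint (r + 1) c .bottom = pt (2 * c + 1) (2 * r + 2) ∧
      sidePoint (r + 1) c .top = pt (2 * c + 1) (2 * r + 4)) ∧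
    (sidePoint (r + 1) (c + 1) .left = pt (2 * c + 2) (2 * r + 3) ∧
      sidePoint (r + 1) (c + 1) .right = pt (2 * c + 4) (2 * r + 3) ∧
      sidePoint (r + 1) (c + 1) .bottom = pt (2 * c + 3) (2 * r + 2) ∧
      sidePoint (r + 1) (c + 1) .top = pt (2 * c + 3) (2 * r + 4)) := by
  refine ⟨⟨?_, ?_, ?_, ?_⟩, ⟨?_, ?_, ?_, ?_⟩, ⟨?_, ?_, ?_, ?_⟩, ?_, ?_, ?_, ?_⟩ <;>
  · ext k
    fin_cases k <;> simp [sidePoint, pt] <;> ring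

/-- The strands in a block of four tiles: lower left, lower right, upper left, upper right. -/
noncomputable def blockSet (r c : ℕ) (t : Tile × Tile × Tile × Tile) : Set (Fin 3 → ℝ) :=
  (tileSet r c t.1 ∪ tileSet r (c + 1) t.2.1) ∪
    (tileSet (r + 1) c t.2.2.1 ∪ tileSet (r + 1) (c + 1) t.2.2.2)

/-- A block with a straight strand along one of its sides may be replaced by the block in which
this strand is pushed to the middle of the block. -/
inductive IsPush : Tile × Tile × Tile × Tile → Tile × Tile × Tile × Tile → Prop
  | bottom : IsPush (.t3a, .t3a, .t2d, .t2c) (.t2d, .t2c, .t4b, .t4a)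
  | top : IsPush (.t2a, .t2b, .t3a, .t3a) (.t4a, .t4b, .t2a, .t2b)
  | left : IsPush (.t3b, .t2b, .t3b, .t2c) (.t2b, .t4b, .t2c, .t4a)
  | right : IsPush (.t2a, .t3b, .t2d, .t3b) (.t4a, .t2a, .t4b, .t2d)

theorem convexHull_triple_induction {A B C x : Fin 3 → ℝ} (hx : x ∈ convexHull ℝ {A, B, C})
    (u v w z : ℝ) (hA : u * A 0 + v * A 1 + w * A 2 ≤ z) (hB : u * B 0 + v * B 1 + w * B 2 ≤ z)
    (hC : u * C 0 + v * C 1 + w * C 2 ≤ z) : u * x 0 + v * x 1 + w * x 2 ≤ z := by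
  refine convexHull_min (t := {x | u * x 0 + v * x 1 + w * x 2 ≤ z}) ?_ ?_ hx
  · rintro y (rfl | rfl | rfl) <;> assumption
  · intro x hx y hy a b ha hb hab
    simp only [Set.mem_ofPred_eq, Pi.add_apply, Pi.smul_apply, smul_eq_mul] at *
    obtain rfl : b = 1 - a := by linarith
    nlinarith [mul_le_mul_of_nonneg_left hx ha, mul_le_mul_of_nonneg_left hy hb]

theorem affineIndependent_pt {x y x' y' x'' y'' : ℝ}
    (h : (x' - x) * (y'' - y) - (x'' - x) * (y' - y) ≠ 0) :
    AffineIndependent ℝ ![pt x y, pt x' y', pt x'' y''] := by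
  rw [affineIndependent_iff_linearIndependent_vsub ℝ _ (0 : Fin 3),
    ← linearIndependent_equiv (finSuccAboveEquiv (0 : Fin 3))]
  rw [show ((fun i : {i // i ≠ (0 : Fin 3)} => (![pt x y, pt x' y', pt x'' y''] i -ᵥ
      ![pt x y, pt x' y', pt x'' y''] 0 : Fin 3 → ℝ)) ∘ finSuccAboveEquiv (0 : Fin 3)) =
      ![pt x' y' - pt x y, pt x'' y'' - pt x y] by
    ext i k
    fin_cases i <;> simp [finSuccAboveEquiv]]
  rw [LinearIndependent.pair_iff]
  intro s t hst
  have h0 := congrFun hst 0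
  have h1 := congrFun hst 1
  simp [pt] at h0 h1
  constructor
  · refine (mul_eq_zero.1 ?_).resolve_right h
    linear_combination (y'' - y) * h0 - (x'' - x) * h1
  · refine (mul_eq_zero.1 ?_).resolve_right h
    linear_combination (x' - x) * h1 - (y' - y) * h0

theorem pt_apply (x y : ℝ) : pt x y 0 = x ∧ pt x y 1 = y ∧ pt x y 2 = 0 := by
  simp [pt]

theorem eq_pt {x : Fin 3 → ℝ} {a b : ℝ} (h0 : x 0 = a) (h1 : x 1 = b) (h2 : x 2 = 0) :
    x = pt a b := by
  ext k
  fin_cases k <;> simpa [pt]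

theorem notMem_convexHull_of_segment {A B C p q : Fin 3 → ℝ} {u v z : ℝ}
    (hA : u * A 0 + v * A 1 ≤ z) (hB : u * B 0 + v * B 1 ≤ z) (hC : u * C 0 + v * C 1 ≤ z)
    (hp : z < u * p 0 + v * p 1) (hq : z < u * q 0 + v * q 1) :
    Disjoint (segment ℝ p q) (convexHull ℝ {A, B, C}) := by
  rw [Set.disjoint_left]
  intro x hx hx'
  have h := convexHull_triple_induction hx' u v 0 z (by linarith) (by linarith) (by linarith)
  obtain ⟨b, hb, hb', e⟩ := mem_segment_coord hx
  rw [e 0, e 1] at h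
  have h1 : 0 ≤ (1 - b) * (u * p 0 + v * p 1 - z) :=
    mul_nonneg (by linarith) (by linarith)
  have h2 : 0 ≤ b * (u * q 0 + v * q 1 - z) := mul_nonneg hb (by linarith)
  rcases hb.eq_or_lt with rfl | hb0
  · linarith
  · have h2' : 0 < b * (u * q 0 + v * q 1 - z) := mul_pos hb0 (by linarith)
    linarith

set_option linter.unusedSimpArgs false in
/-- Pushing a strand across a block is a triangle move inside the block. -/
theorem IsPush.exists_triangle {t t' : Tile × Tile × Tile × Tile} (h : IsPush t t') (r c : ℕ) :
    ∃ (A B C : Fin 3 → ℝ) (Q : Set (Fin 3 → ℝ)), AffineIndependent ℝ ![A, B, C] ∧ IsClosed Q ∧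
      blockSet r c t = Q ∪ segment ℝ A B ∧
      blockSet r c t' = Q ∪ (segment ℝ A C ∪ segment ℝ C B) ∧
      Disjoint Q (convexHull ℝ {A, B, C}) ∧
      ∀ x ∈ convexHull ℝ {A, B, C}, ∀ i j : ℕ, ¬ ((i = r ∨ i = r + 1) ∧ (j = c ∨ j = c + 1)) →
        2 * (j : ℝ) ≤ x 0 → x 0 ≤ 2 * (j : ℝ) + 2 → 2 * (i : ℝ) ≤ x 1 →
        x 1 ≤ 2 * (i : ℝ) + 2 → x = A ∨ x = B := by
  obtain ⟨⟨p1, p2, p3, p4⟩, ⟨p5, p6, p7, p8⟩, ⟨p9, p10, p11, p12⟩, p13, p14, p15, p16⟩ :=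
    block_sidePoint r c
  have hout : ∀ i j : ℕ, ¬ ((i = r ∨ i = r + 1) ∧ (j = c ∨ j = c + 1)) →
      ((i : ℝ) + 1 ≤ r ∨ (r : ℝ) + 2 ≤ i) ∨ ((j : ℝ) + 1 ≤ c ∨ (c : ℝ) + 2 ≤ j) := by
    intro i j hij
    norm_cast
    omega
  have tileSet_two : ∀ i j s s' u u', ∀ t : Tile, t.strands = [(s, s', 0), (u, u', 0)] →
      tileSet i j t = segment ℝ (sidePoint i j s) (sidePoint i j s') ∪
        segment ℝ (sidePoint i j u) (sidePoint i j u') := by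
    intro i j s s' u u' t ht
    ext x
    simp [mem_tileSet, ht, strandSet_zero]
  have tileSet_one : ∀ i j s s', ∀ t : Tile, t.strands = [(s, s', 0)] →
      tileSet i j t = segment ℝ (sidePoint i j s) (sidePoint i j s') := by
    intro i j s s' t ht
    ext x
    simp [mem_tileSet, ht, strandSet_zero]
  have t2a := fun i j => tileSet_one i j _ _ .t2a rfl
  have t2b := fun i j => tileSet_one i j _ _ .t2b rfl
  have t2c := fun i j => tileSet_one i j _ _ .t2c rfl
  have t2d := fun i j => tileSet_one i j _ _ .t2d rfl
  have t3a := fun i j => tileSet_one i j _ _ .t3a rfl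
  have t3b := fun i j => tileSet_one i j _ _ .t3b rfl
  have t4a := fun i j => tileSet_two i j _ _ _ _ .t4a rfl
  have t4b := fun i j => tileSet_two i j _ _ _ _ .t4b rfl
  clear tileSet_one tileSet_two
  generalize (r : ℝ) = y at *
  generalize (c : ℝ) = x at *
  cases h
  · have e1 : segment ℝ (pt (2 * x) (2 * y + 1)) (pt (2 * x + 4) (2 * y + 1)) =
        segment ℝ (pt (2 * x) (2 * y + 1)) (pt (2 * x + 2) (2 * y + 1)) ∪
          segment ℝ (pt (2 * x + 2) (2 * y + 1)) (pt (2 * x + 4) (2 * y + 1)) :=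
      pt_segment_union (by ring) (by ring)
    have e2 : segment ℝ (pt (2 * x) (2 * y + 1)) (pt (2 * x + 2) (2 * y + 3)) =
        segment ℝ (pt (2 * x) (2 * y + 1)) (pt (2 * x + 1) (2 * y + 2)) ∪
          segment ℝ (pt (2 * x + 1) (2 * y + 2)) (pt (2 * x + 2) (2 * y + 3)) :=
      pt_segment_union (by ring) (by ring)
    have e3 : segment ℝ (pt (2 * x + 2) (2 * y + 3)) (pt (2 * x + 4) (2 * y + 1)) =
        segment ℝ (pt (2 * x + 2) (2 * y + 3)) (pt (2 * x + 3) (2 * y + 2)) ∪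
          segment ℝ (pt (2 * x + 3) (2 * y + 2)) (pt (2 * x + 4) (2 * y + 1)) :=
      pt_segment_union (by ring) (by ring)
    -- `A` and `B` are the ends of the straight strand and `C` is the midpoint of the common side of
    -- the two upper tiles. `Q` consists of the two arcs that do not move; the lines `AC` and `CB`
    -- separate them from the triangle. The other three cases have the same shape.
    refine ⟨pt (2 * x) (2 * y + 1), pt (2 * x + 4) (2 * y + 1), pt (2 * x + 2) (2 * y + 3),
      segment ℝ (pt (2 * x + 1) (2 * y + 4)) (pt (2 * x) (2 * y + 3)) ∪
        segment ℝ (pt (2 * x + 4) (2 * y + 3)) (pt (2 * x + 3) (2 * y + 4)),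
      affineIndependent_pt (by ring_nf; norm_num),
      (isClosed_segment_pi _ _).union (isClosed_segment_pi _ _), ?_, ?_, ?_, ?_⟩
    · simp only [blockSet, t2c, t2d, t3a, p1, p2, p3, p4, p5, p6, p7, p8, p9, p10, p11, p12, p13, p14,
        p15, p16, e1]
      ext z
      simp only [Set.mem_union]
      tauto
    · simp only [blockSet, t2c, t2d, t4a, t4b, p1, p2, p3, p4, p5, p6, p7, p8, p9, p10, p11, p12, p13,
        p14, p15, p16, e2, e3]
      rw [segment_symm ℝ (pt (2 * x + 1) (2 * y + 2)) (pt (2 * x) (2 * y + 1)),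
        segment_symm ℝ (pt (2 * x + 4) (2 * y + 1)) (pt (2 * x + 3) (2 * y + 2))]
      ext z
      simp only [Set.mem_union]
      tauto
    · refine Set.disjoint_union_left.2
        ⟨notMem_convexHull_of_segment (u := -1) (v := 1) (z := 1 - 2 * x + 2 * y) ?_ ?_ ?_
          ?_ ?_,
        notMem_convexHull_of_segment (u := 1) (v := 1) (z := 5 + 2 * x + 2 * y) ?_ ?_ ?_
          ?_ ?_⟩ <;>
        simp only [pt_apply] <;> linarith
    · intro z hz i j hij h1 h2 h3 h4
      have f1 := convexHull_triple_induction hz (-1) 1 0 (1 - 2 * x + 2 * y)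
        (by simp only [pt_apply]; linarith) (by simp only [pt_apply]; linarith)
        (by simp only [pt_apply]; linarith)
      have f2 := convexHull_triple_induction hz 1 1 0 (5 + 2 * x + 2 * y)
        (by simp only [pt_apply]; linarith) (by simp only [pt_apply]; linarith)
        (by simp only [pt_apply]; linarith)
      have f3 := convexHull_triple_induction hz 0 (-1) 0 (-1 - 2 * y)
        (by simp only [pt_apply]; linarith) (by simp only [pt_apply]; linarith)
        (by simp only [pt_apply]; linarith)
      have f4 := convexHull_triple_induction hz 0 0 1 (0)
        (by simp only [pt_apply]; linarith) (by simp only [pt_apply]; linarith)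
        (by simp only [pt_apply]; linarith)
      have f5 := convexHull_triple_induction hz 0 0 (-1) (0)
        (by simp only [pt_apply]; linarith) (by simp only [pt_apply]; linarith)
        (by simp only [pt_apply]; linarith)
      -- The triangle lies in the block and touches its boundary only at `A` and `B`; `f4` and `f5`
      -- keep it at height zero.
      rcases hout i j hij with (h | h) | h | h
      · linarith
      · linarith
      · exact Or.inl (eq_pt (by linarith) (by linarith) (by linarith))
      · exact Or.inr (eq_pt (by linarith) (by linarith) (by linarith))
  · have e1 : segment ℝ (pt (2 * x) (2 * y + 3)) (pt (2 * x + 4) (2 * y + 3)) =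
        segment ℝ (pt (2 * x) (2 * y + 3)) (pt (2 * x + 2) (2 * y + 3)) ∪
          segment ℝ (pt (2 * x + 2) (2 * y + 3)) (pt (2 * x + 4) (2 * y + 3)) :=
      pt_segment_union (by ring) (by ring)
    have e2 : segment ℝ (pt (2 * x) (2 * y + 3)) (pt (2 * x + 2) (2 * y + 1)) =
        segment ℝ (pt (2 * x) (2 * y + 3)) (pt (2 * x + 1) (2 * y + 2)) ∪
          segment ℝ (pt (2 * x + 1) (2 * y + 2)) (pt (2 * x + 2) (2 * y + 1)) :=
      pt_segment_union (by ring) (by ring)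
    have e3 : segment ℝ (pt (2 * x + 2) (2 * y + 1)) (pt (2 * x + 4) (2 * y + 3)) =
        segment ℝ (pt (2 * x + 2) (2 * y + 1)) (pt (2 * x + 3) (2 * y + 2)) ∪
          segment ℝ (pt (2 * x + 3) (2 * y + 2)) (pt (2 * x + 4) (2 * y + 3)) :=
      pt_segment_union (by ring) (by ring)
    refine ⟨pt (2 * x) (2 * y + 3), pt (2 * x + 4) (2 * y + 3), pt (2 * x + 2) (2 * y + 1),
      segment ℝ (pt (2 * x) (2 * y + 1)) (pt (2 * x + 1) (2 * y)) ∪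
        segment ℝ (pt (2 * x + 3) (2 * y)) (pt (2 * x + 4) (2 * y + 1)),
      affineIndependent_pt (by ring_nf; norm_num),
      (isClosed_segment_pi _ _).union (isClosed_segment_pi _ _), ?_, ?_, ?_, ?_⟩
    · simp only [blockSet, t2a, t2b, t3a, p1, p2, p3, p4, p5, p6, p7, p8, p9, p10, p11, p12, p13, p14,
        p15, p16, e1]
    · simp only [blockSet, t2a, t2b, t4a, t4b, p1, p2, p3, p4, p5, p6, p7, p8, p9, p10, p11, p12, p13,
        p14, p15, p16, e2, e3]
      rw [segment_symm ℝ (pt (2 * x + 2) (2 * y + 1)) (pt (2 * x + 1) (2 * y + 2)),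
        segment_symm ℝ (pt (2 * x + 3) (2 * y + 2)) (pt (2 * x + 2) (2 * y + 1))]
      ext z
      simp only [Set.mem_union]
      tauto
    · refine Set.disjoint_union_left.2
        ⟨notMem_convexHull_of_segment (u := -1) (v := -1) (z := -3 - 2 * x - 2 * y) ?_ ?_ ?_
          ?_ ?_,
        notMem_convexHull_of_segment (u := 1) (v := -1) (z := 1 + 2 * x - 2 * y) ?_ ?_ ?_
          ?_ ?_⟩ <;>
        simp only [pt_apply] <;> linarith
    · intro z hz i j hij h1 h2 h3 h4
      have f1 := convexHull_triple_induction hz (-1) (-1) 0 (-3 - 2 * x - 2 * y)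
        (by simp only [pt_apply]; linarith) (by simp only [pt_apply]; linarith)
        (by simp only [pt_apply]; linarith)
      have f2 := convexHull_triple_induction hz 1 (-1) 0 (1 + 2 * x - 2 * y)
        (by simp only [pt_apply]; linarith) (by simp only [pt_apply]; linarith)
        (by simp only [pt_apply]; linarith)
      have f3 := convexHull_triple_induction hz 0 1 0 (3 + 2 * y)
        (by simp only [pt_apply]; linarith) (by simp only [pt_apply]; linarith)
        (by simp only [pt_apply]; linarith)
      have f4 := convexHull_triple_induction hz 0 0 1 (0)
        (by simp only [pt_apply]; linarith) (by simp only [pt_apply]; linarith)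
        (by simp only [pt_apply]; linarith)
      have f5 := convexHull_triple_induction hz 0 0 (-1) (0)
        (by simp only [pt_apply]; linarith) (by simp only [pt_apply]; linarith)
        (by simp only [pt_apply]; linarith)
      rcases hout i j hij with (h | h) | h | h
      · linarith
      · linarith
      · exact Or.inl (eq_pt (by linarith) (by linarith) (by linarith))
      · exact Or.inr (eq_pt (by linarith) (by linarith) (by linarith))
  · have e1 : segment ℝ (pt (2 * x + 1) (2 * y)) (pt (2 * x + 1) (2 * y + 4)) =
        segment ℝ (pt (2 * x + 1) (2 * y)) (pt (2 * x + 1) (2 * y + 2)) ∪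
          segment ℝ (pt (2 * x + 1) (2 * y + 2)) (pt (2 * x + 1) (2 * y + 4)) :=
      pt_segment_union (by ring) (by ring)
    have e2 : segment ℝ (pt (2 * x + 1) (2 * y)) (pt (2 * x + 3) (2 * y + 2)) =
        segment ℝ (pt (2 * x + 1) (2 * y)) (pt (2 * x + 2) (2 * y + 1)) ∪
          segment ℝ (pt (2 * x + 2) (2 * y + 1)) (pt (2 * x + 3) (2 * y + 2)) :=
      pt_segment_union (by ring) (by ring)
    have e3 : segment ℝ (pt (2 * x + 3) (2 * y + 2)) (pt (2 * x + 1) (2 * y + 4)) =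
        segment ℝ (pt (2 * x + 3) (2 * y + 2)) (pt (2 * x + 2) (2 * y + 3)) ∪
          segment ℝ (pt (2 * x + 2) (2 * y + 3)) (pt (2 * x + 1) (2 * y + 4)) :=
      pt_segment_union (by ring) (by ring)
    refine ⟨pt (2 * x + 1) (2 * y), pt (2 * x + 1) (2 * y + 4), pt (2 * x + 3) (2 * y + 2),
      segment ℝ (pt (2 * x + 3) (2 * y)) (pt (2 * x + 4) (2 * y + 1)) ∪
        segment ℝ (pt (2 * x + 4) (2 * y + 3)) (pt (2 * x + 3) (2 * y + 4)),
      affineIndependent_pt (by ring_nf; norm_num),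
      (isClosed_segment_pi _ _).union (isClosed_segment_pi _ _), ?_, ?_, ?_, ?_⟩
    · simp only [blockSet, t2b, t2c, t3b, p1, p2, p3, p4, p5, p6, p7, p8, p9, p10, p11, p12, p13, p14,
        p15, p16, e1]
      ext z
      simp only [Set.mem_union]
      tauto
    · simp only [blockSet, t2b, t2c, t4a, t4b, p1, p2, p3, p4, p5, p6, p7, p8, p9, p10, p11, p12, p13,
        p14, p15, p16, e2, e3]
      rw [segment_symm ℝ (pt (2 * x + 3) (2 * y + 2)) (pt (2 * x + 2) (2 * y + 1)),
        segment_symm ℝ (pt (2 * x + 2) (2 * y + 3)) (pt (2 * x + 3) (2 * y + 2))]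
      ext z
      simp only [Set.mem_union]
      tauto
    · refine Set.disjoint_union_left.2
        ⟨notMem_convexHull_of_segment (u := 1) (v := -1) (z := 1 + 2 * x - 2 * y) ?_ ?_ ?_
          ?_ ?_,
        notMem_convexHull_of_segment (u := 1) (v := 1) (z := 5 + 2 * x + 2 * y) ?_ ?_ ?_
          ?_ ?_⟩ <;>
        simp only [pt_apply] <;> linarith
    · intro z hz i j hij h1 h2 h3 h4
      have f1 := convexHull_triple_induction hz 1 (-1) 0 (1 + 2 * x - 2 * y)
        (by simp only [pt_apply]; linarith) (by simp only [pt_apply]; linarith)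
        (by simp only [pt_apply]; linarith)
      have f2 := convexHull_triple_induction hz 1 1 0 (5 + 2 * x + 2 * y)
        (by simp only [pt_apply]; linarith) (by simp only [pt_apply]; linarith)
        (by simp only [pt_apply]; linarith)
      have f3 := convexHull_triple_induction hz (-1) 0 0 (-1 - 2 * x)
        (by simp only [pt_apply]; linarith) (by simp only [pt_apply]; linarith)
        (by simp only [pt_apply]; linarith)
      have f4 := convexHull_triple_induction hz 0 0 1 (0)
        (by simp only [pt_apply]; linarith) (by simp only [pt_apply]; linarith)
        (by simp only [pt_apply]; linarith)
      have f5 := convexHull_triple_induction hz 0 0 (-1) (0)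
        (by simp only [pt_apply]; linarith) (by simp only [pt_apply]; linarith)
        (by simp only [pt_apply]; linarith)
      rcases hout i j hij with (h | h) | h | h
      · exact Or.inl (eq_pt (by linarith) (by linarith) (by linarith))
      · exact Or.inr (eq_pt (by linarith) (by linarith) (by linarith))
      · linarith
      · linarith
  · have e1 : segment ℝ (pt (2 * x + 3) (2 * y)) (pt (2 * x + 3) (2 * y + 4)) =
        segment ℝ (pt (2 * x + 3) (2 * y)) (pt (2 * x + 3) (2 * y + 2)) ∪
          segment ℝ (pt (2 * x + 3) (2 * y + 2)) (pt (2 * x + 3) (2 * y + 4)) :=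
      pt_segment_union (by ring) (by ring)
    have e2 : segment ℝ (pt (2 * x + 3) (2 * y)) (pt (2 * x + 1) (2 * y + 2)) =
        segment ℝ (pt (2 * x + 3) (2 * y)) (pt (2 * x + 2) (2 * y + 1)) ∪
          segment ℝ (pt (2 * x + 2) (2 * y + 1)) (pt (2 * x + 1) (2 * y + 2)) :=
      pt_segment_union (by ring) (by ring)
    have e3 : segment ℝ (pt (2 * x + 1) (2 * y + 2)) (pt (2 * x + 3) (2 * y + 4)) =
        segment ℝ (pt (2 * x + 1) (2 * y + 2)) (pt (2 * x + 2) (2 * y + 3)) ∪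
          segment ℝ (pt (2 * x + 2) (2 * y + 3)) (pt (2 * x + 3) (2 * y + 4)) :=
      pt_segment_union (by ring) (by ring)
    refine ⟨pt (2 * x + 3) (2 * y), pt (2 * x + 3) (2 * y + 4), pt (2 * x + 1) (2 * y + 2),
      segment ℝ (pt (2 * x) (2 * y + 1)) (pt (2 * x + 1) (2 * y)) ∪
        segment ℝ (pt (2 * x + 1) (2 * y + 4)) (pt (2 * x) (2 * y + 3)),
      affineIndependent_pt (by ring_nf; norm_num),
      (isClosed_segment_pi _ _).union (isClosed_segment_pi _ _), ?_, ?_, ?_, ?_⟩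
    · simp only [blockSet, t2a, t2d, t3b, p1, p2, p3, p4, p5, p6, p7, p8, p9, p10, p11, p12, p13, p14,
        p15, p16, e1]
      ext z
      simp only [Set.mem_union]
      tauto
    · simp only [blockSet, t2a, t2d, t4a, t4b, p1, p2, p3, p4, p5, p6, p7, p8, p9, p10, p11, p12, p13,
        p14, p15, p16, e2, e3]
      rw [segment_symm ℝ (pt (2 * x + 2) (2 * y + 1)) (pt (2 * x + 3) (2 * y)),
        segment_symm ℝ (pt (2 * x + 3) (2 * y + 4)) (pt (2 * x + 2) (2 * y + 3))]
      ext z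
      simp only [Set.mem_union]
      tauto
    · refine Set.disjoint_union_left.2
        ⟨notMem_convexHull_of_segment (u := -1) (v := -1) (z := -3 - 2 * x - 2 * y) ?_ ?_ ?_
          ?_ ?_,
        notMem_convexHull_of_segment (u := -1) (v := 1) (z := 1 - 2 * x + 2 * y) ?_ ?_ ?_
          ?_ ?_⟩ <;>
        simp only [pt_apply] <;> linarith
    · intro z hz i j hij h1 h2 h3 h4
      have f1 := convexHull_triple_induction hz (-1) (-1) 0 (-3 - 2 * x - 2 * y)
        (by simp only [pt_apply]; linarith) (by simp only [pt_apply]; linarith)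
        (by simp only [pt_apply]; linarith)
      have f2 := convexHull_triple_induction hz (-1) 1 0 (1 - 2 * x + 2 * y)
        (by simp only [pt_apply]; linarith) (by simp only [pt_apply]; linarith)
        (by simp only [pt_apply]; linarith)
      have f3 := convexHull_triple_induction hz 1 0 0 (3 + 2 * x)
        (by simp only [pt_apply]; linarith) (by simp only [pt_apply]; linarith)
        (by simp only [pt_apply]; linarith)
      have f4 := convexHull_triple_induction hz 0 0 1 (0)
        (by simp only [pt_apply]; linarith) (by simp only [pt_apply]; linarith)
        (by simp only [pt_apply]; linarith)
      have f5 := convexHull_triple_induction hz 0 0 (-1) (0)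
        (by simp only [pt_apply]; linarith) (by simp only [pt_apply]; linarith)
        (by simp only [pt_apply]; linarith)
      rcases hout i j hij with (h | h) | h | h
      · exact Or.inl (eq_pt (by linarith) (by linarith) (by linarith))
      · exact Or.inr (eq_pt (by linarith) (by linarith) (by linarith))
      · linarith
      · linarith

theorem tileSet_bounds {i j : ℕ} {t : Tile} {x : Fin 3 → ℝ} (hx : x ∈ tileSet i j t) :
    (2 * (j : ℝ) ≤ x 0 ∧ x 0 ≤ 2 * (j : ℝ) + 2) ∧ 2 * (i : ℝ) ≤ x 1 ∧
      x 1 ≤ 2 * (i : ℝ) + 2 := by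
  obtain ⟨c, hc, hx⟩ := mem_tileSet.1 hx
  have side : ∀ s, (2 * (j : ℝ) ≤ sidePoint i j s 0 ∧ sidePoint i j s 0 ≤ 2 * (j : ℝ) + 2) ∧
      2 * (i : ℝ) ≤ sidePoint i j s 1 ∧ sidePoint i j s 1 ≤ 2 * (i : ℝ) + 2 := by
    intro s
    cases s <;> simp [sidePoint]
  rcases strandSet_cases (strand_ne hc) hx with rfl | rfl | h
  · exact side _
  · exact side _
  · exact ⟨⟨h.1.1.le, h.1.2.le⟩, h.2.1.le, h.2.2.le⟩

/-- A locally constant function on `R ∪ T` is transferred to `R ∪ S` by making it constant on `S`.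
The two definitions agree on `R ∩ S`, which lies in the preconnected set `T`, and they glue because
`R` and `S` are closed. -/
theorem IsPreconnected.replace_arc {X : Type*} [TopologicalSpace X] {R S T : Set X} {a : X}
    (hR : IsClosed R) (hS : IsClosed S) (h : IsPreconnected (R ∪ S)) (hT : IsPreconnected T)
    (ha : a ∈ S) (haT : a ∈ T) (hRS : R ∩ S ⊆ T) : IsPreconnected (R ∪ T) := by
  classical
  refine isPreconnected_of_forall_constant fun f hf => ?_
  have hfT : ∀ x ∈ T, f x = f a := fun x hx =>
    hT.constant (hf.mono Set.subset_union_right) hx haT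
  let g : X → Bool := fun x => if x ∈ S then f a else f x
  have hgS : ∀ x ∈ S, g x = f a := fun x hx => if_pos hx
  have hgR : ∀ x ∈ R, g x = f x := by
    intro x hx
    by_cases hxS : x ∈ S
    · rw [hgS x hxS, hfT x (hRS ⟨hx, hxS⟩)]
    · exact if_neg hxS
  have hg : ContinuousOn g (R ∪ S) :=
    ((hf.mono Set.subset_union_left).congr hgR).union_of_isClosed
      (continuousOn_const.congr hgS) hR hS
  have hfR : ∀ x ∈ R, f x = f a := fun x hx => by
    rw [← hgR x hx, ← hgS a ha]
    exact h.constant hg (Or.inl hx) (Or.inr ha)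
  have hfa : ∀ x ∈ R ∪ T, f x = f a := by
    rintro x (hx | hx)
    exacts [hfR x hx, hfT x hx]
  intro x hx y hy
  rw [hfa x hx, hfa y hy]

/-- Replacing a side of a triangle by the two other sides. -/
theorem triangleMove_of_disjoint {R : Set (Fin 3 → ℝ)} {A B C : Fin 3 → ℝ}
    (hABC : AffineIndependent ℝ ![A, B, C])
    (hR : ∀ x ∈ R, x ∈ convexHull ℝ {A, B, C} → x = A ∨ x = B) :
    TriangleMove (R ∪ segment ℝ A B) (R ∪ (segment ℝ A C ∪ segment ℝ C B)) := by
  have hAB : segment ℝ A B ⊆ convexHull ℝ {A, B, C} :=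
    segment_subset_convexHull (by simp) (by simp)
  refine ⟨A, B, C, hABC, ?_, ?_⟩
  · ext x
    constructor
    · rintro ⟨hx | hx, hx'⟩
      · rcases hR x hx hx' with rfl | rfl
        · exact left_mem_segment ℝ _ _
        · exact right_mem_segment ℝ _ _
      · exact hx
    · exact fun hx => ⟨Or.inr hx, hAB hx⟩
  · ext x
    constructor
    · rintro (hx | hx)
      · by_cases hx' : x ∈ segment ℝ A B
        · rcases hR x hx (hAB hx') with rfl | rfl
          · exact Or.inr (Or.inl (left_mem_segment ℝ _ _))
          · exact Or.inr (Or.inr (right_mem_segment ℝ _ _))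
        · exact Or.inl ⟨Or.inl hx, hx'⟩
      · exact Or.inr hx
    · rintro (⟨hx | hx, hx'⟩ | hx)
      · exact Or.inl hx
      · exact absurd hx hx'
      · exact Or.inr hx

/-! ### Replacing a block of a mosaic -/

/-- Replace the tiles in the block with lower left corner in row `r` and column `c`. -/
def blockUpdate (f : ℕ → ℕ → Tile) (r c : ℕ) (t : Tile × Tile × Tile × Tile) (i j : ℕ) : Tile :=
  if i = r then if j = c then t.1 else if j = c + 1 then t.2.1 else f i j
  else if i = r + 1 then if j = c then t.2.2.1 else if j = c + 1 then t.2.2.2 else f i j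
  else f i j

/-- The tiles of a block. -/
def blockAt (f : ℕ → ℕ → Tile) (r c : ℕ) : Tile × Tile × Tile × Tile :=
  (f r c, f r (c + 1), f (r + 1) c, f (r + 1) (c + 1))

theorem blockAt_blockUpdate (f : ℕ → ℕ → Tile) (r c : ℕ) (t : Tile × Tile × Tile × Tile) :
    blockAt (blockUpdate f r c t) r c = t := by
  simp [blockAt, blockUpdate]

theorem blockUpdate_of_not {f : ℕ → ℕ → Tile} {r c : ℕ} {t : Tile × Tile × Tile × Tile}
    {i j : ℕ} (h : ¬ ((i = r ∨ i = r + 1) ∧ (j = c ∨ j = c + 1))) :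
    blockUpdate f r c t i j = f i j := by
  unfold blockUpdate
  split_ifs <;> first | rfl | (exfalso; omega)

namespace Mosaic

variable {n : ℕ} (M : Mosaic n)

/-- The part of the realization outside a block. -/
def outside (r c : ℕ) : Set (Fin 3 → ℝ) :=
  ⋃ i ∈ Set.Iio n, ⋃ j ∈ {j | j < n ∧ ¬ ((i = r ∨ i = r + 1) ∧ (j = c ∨ j = c + 1))},
    tileSet i j (M.tileAt i j)

theorem mem_outside {r c : ℕ} {x : Fin 3 → ℝ} : x ∈ M.outside r c ↔
    ∃ i j, i < n ∧ j < n ∧ ¬ ((i = r ∨ i = r + 1) ∧ (j = c ∨ j = c + 1)) ∧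
      x ∈ tileSet i j (M.tileAt i j) := by
  simp only [outside, Set.mem_iUnion, Set.mem_Iio, Set.mem_ofPred_eq]
  constructor
  · rintro ⟨i, hi, j, hj, hx⟩
    exact ⟨i, j, hi, hj.1, hj.2, hx⟩
  · rintro ⟨i, j, hi, hj, hij, hx⟩
    exact ⟨i, hi, j, ⟨hj, hij⟩, hx⟩

theorem isClosed_outside (r c : ℕ) : IsClosed (M.outside r c) :=
  (Set.finite_Iio n).isClosed_biUnion fun i _ =>
    ((Set.finite_Iio n).subset fun _ h => h.1).isClosed_biUnion fun j _ => isClosed_tileSet i j _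

theorem realization_eq {r c : ℕ} (hr : r + 1 < n) (hc : c + 1 < n) :
    M.realization = M.outside r c ∪ blockSet r c (blockAt M.tileAt r c) := by
  ext x
  rw [mem_realization, Set.mem_union, mem_outside]
  constructor
  · rintro ⟨i, j, hi, hj, hx⟩
    by_cases hij : (i = r ∨ i = r + 1) ∧ (j = c ∨ j = c + 1)
    · right
      rcases hij with ⟨rfl | rfl, rfl | rfl⟩
      · exact Or.inl (Or.inl hx)
      · exact Or.inl (Or.inr hx)
      · exact Or.inr (Or.inl hx)
      · exact Or.inr (Or.inr hx)
    · exact Or.inl ⟨i, j, hi, hj, hij, hx⟩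
  · rintro (⟨i, j, hi, hj, -, hx⟩ | (hx | hx) | hx | hx)
    · exact ⟨i, j, hi, hj, hx⟩
    · exact ⟨r, c, by omega, by omega, hx⟩
    · exact ⟨r, c + 1, by omega, by omega, hx⟩
    · exact ⟨r + 1, c, by omega, by omega, hx⟩
    · exact ⟨r + 1, c + 1, by omega, by omega, hx⟩

end Mosaic

/-- Pushing a strand does not change which outer sides of the block are met, and the new tiles
match along their common sides. -/
theorem IsPush.meets {a b c d a' b' c' d' : Tile} (h : IsPush (a, b, c, d) (a', b', c', d')) :
    ((a'.Meets .left ↔ a.Meets .left) ∧ (c'.Meets .left ↔ c.Meets .left) ∧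
      (b'.Meets .right ↔ b.Meets .right) ∧ (d'.Meets .right ↔ d.Meets .right)) ∧
    ((a'.Meets .bottom ↔ a.Meets .bottom) ∧ (b'.Meets .bottom ↔ b.Meets .bottom) ∧
      (c'.Meets .top ↔ c.Meets .top) ∧ (d'.Meets .top ↔ d.Meets .top)) ∧
    ((a'.Meets .right ↔ b'.Meets .left) ∧ (c'.Meets .right ↔ d'.Meets .left) ∧
      (a'.Meets .top ↔ c'.Meets .bottom) ∧ (b'.Meets .top ↔ d'.Meets .bottom)) := by
  cases h <;> decide

theorem IsPush.ne {a b c d a' b' c' d' : Tile} (h : IsPush (a, b, c, d) (a', b', c', d')) :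
    a' ≠ .t0 ∧ b' ≠ .t0 ∧ c' ≠ .t0 ∧ d' ≠ .t0 := by
  cases h <;> decide

/-- The triangle meets the rest of the link at most in `A` and `B`, so the replacement is a single
triangle move and keeps the link connected. The outer sides met by the block are unchanged, so the
new block still fits. -/
theorem Mosaic.exists_push {n : ℕ} {M : Mosaic n} (hM : M.IsKnotMosaic) {r c : ℕ}
    (hr : r + 1 < n) (hc : c + 1 < n) {t' : Tile × Tile × Tile × Tile}
    (h : IsPush (blockAt M.tileAt r c) t') :
    ∃ M' : Mosaic n, (∀ i j, M'.tileAt i j = blockUpdate M.tileAt r c t' i j) ∧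
      M'.IsKnotMosaic ∧ TriangleMove M.realization M'.realization := by
  obtain ⟨a', b', c', d'⟩ := t'
  have hne := h.ne
  let M' : Mosaic n :=
    { tile := fun i j => blockUpdate M.tileAt r c (a', b', c', d') i j
      tile_ne := by
        intro i j
        have := M.tileAt_ne i j
        unfold blockUpdate
        split_ifs <;> tauto }
  have hM' : ∀ i j, M'.tileAt i j = blockUpdate M.tileAt r c (a', b', c', d') i j := by
    intro i j
    by_cases hij : i < n ∧ j < n
    · simp [M', tileAt, hij]
    · rw [M'.tileAt_of_not hij, blockUpdate_of_not (by omega), M.tileAt_of_not hij]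
  have hout : M'.outside r c = M.outside r c := by
    ext x
    simp only [mem_outside]
    constructor
    · rintro ⟨i, j, hi, hj, hij, hx⟩
      rw [hM', blockUpdate_of_not hij] at hx
      exact ⟨i, j, hi, hj, hij, hx⟩
    · rintro ⟨i, j, hi, hj, hij, hx⟩
      refine ⟨i, j, hi, hj, hij, ?_⟩
      rwa [hM', blockUpdate_of_not hij]
  have hblock : blockAt M'.tileAt r c = (a', b', c', d') := by
    rw [show M'.tileAt = _ from funext fun i => funext fun j => hM' i j, blockAt_blockUpdate]
  obtain ⟨A, B, C, Q, hABC, hQ, hold, hnew, hdis, hfar⟩ := h.exists_triangle r c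
  have e1 : M.realization = (M.outside r c ∪ Q) ∪ segment ℝ A B := by
    rw [M.realization_eq hr hc, hold, Set.union_assoc]
  have e2 : M'.realization = (M.outside r c ∪ Q) ∪ (segment ℝ A C ∪ segment ℝ C B) := by
    rw [M'.realization_eq hr hc, hblock, hnew, hout, Set.union_assoc (M.outside r c)]
  have hR : ∀ x ∈ M.outside r c ∪ Q, x ∈ convexHull ℝ {A, B, C} → x = A ∨ x = B := by
    rintro x (hx | hx) hx'
    · obtain ⟨i, j, hi, hj, hij, hx⟩ := M.mem_outside.1 hx
      obtain ⟨⟨h1, h2⟩, h3, h4⟩ := tileSet_bounds hx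
      exact hfar x hx' i j hij h1 h2 h3 h4
    · exact (Set.disjoint_left.1 hdis hx hx').elim
  refine ⟨M', hM', ⟨?_, ?_⟩, ?_⟩
  · obtain ⟨s1, s2, s3, s4⟩ := M.suitablyConnected_iff.1 hM.1
    obtain ⟨⟨m1, m2, m3, m4⟩, ⟨m5, m6, m7, m8⟩, m9, m10, m11, m12⟩ := h.meets
    refine M'.suitablyConnected_iff.2 ⟨fun i j => ?_, fun i j => ?_, fun i => ?_, fun j => ?_⟩
    · simp only [hM', blockUpdate]
      have := s1 i j
      grind
    · simp only [hM', blockUpdate]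
      have := s2 i j
      grind
    · simp only [hM', blockUpdate]
      have := s3 i
      grind
    · simp only [hM', blockUpdate]
      have := s4 j
      grind
  · refine ⟨?_, ?_⟩
    · rw [e2]
      exact ⟨A, Or.inr (Or.inl (left_mem_segment ℝ _ _))⟩
    · have hpath : IsPreconnected (segment ℝ A C ∪ segment ℝ C B) :=
        (convex_segment A C).isPreconnected.union C (right_mem_segment ℝ _ _)
          (left_mem_segment ℝ _ _) (convex_segment C B).isPreconnected
      have hpre := hM.2.isPreconnected
      rw [e1] at hpre
      rw [e2]
      refine IsPreconnected.replace_arc ((M.isClosed_outside r c).union hQ)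
        (isClosed_segment_pi A B) hpre hpath (left_mem_segment ℝ A B)
        (Or.inl (left_mem_segment ℝ _ _)) ?_
      rintro x ⟨hx, hx'⟩
      rcases hR x hx (segment_subset_convexHull (by simp) (by simp) hx') with rfl | rfl
      · exact Or.inl (left_mem_segment ℝ _ _)
      · exact Or.inr (right_mem_segment ℝ _ _)
  · rw [e1, e2]
    exact triangleMove_of_disjoint hABC hR

/-! ### Recognising edge arcs on the mosaic -/

namespace Mosaic

variable {N : ℕ} {M : Mosaic (N + 2)}

theorem sideGrid_sides (hM : M.IsKnotMosaic) (i j : ℕ) : (M.sideGrid hM).sides i j =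
    (decide ((M.tileAt i j).Meets .left), decide ((M.tileAt i j).Meets .right),
      decide ((M.tileAt i j).Meets .bottom), decide ((M.tileAt i j).Meets .top)) := by
  obtain ⟨h1, h2, -, -⟩ := M.suitablyConnected_iff.1 hM.1
  have e1 : decide ((M.tileAt i (j + 1)).Meets .left) = decide ((M.tileAt i j).Meets .right) :=
    decide_eq_decide.2 (h1 i j).symm
  have e2 : decide ((M.tileAt (i + 1) j).Meets .bottom) = decide ((M.tileAt i j).Meets .top) :=
    decide_eq_decide.2 (h2 i j).symm
  simp only [SideGrid.sides, sideGrid, e1, e2]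

end Mosaic

/-- A tile meeting exactly two sides is determined by them; only four met sides leave a choice,
between types IV and V. -/
theorem tile_eq_of_meets (t : Tile) (ht : t ≠ .t0) {a b c d : Bool}
    (h : (decide (t.Meets .left), decide (t.Meets .right), decide (t.Meets .bottom),
      decide (t.Meets .top)) = (a, b, c, d)) :
    ((a, b, c, d) = (true, true, false, false) → t = .t3a) ∧
    ((a, b, c, d) = (false, false, true, true) → t = .t3b) ∧
    ((a, b, c, d) = (true, false, true, false) → t = .t2a) ∧
    ((a, b, c, d) = (false, true, true, false) → t = .t2b) ∧
    ((a, b, c, d) = (false, true, false, true) → t = .t2c) ∧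
    ((a, b, c, d) = (true, false, false, true) → t = .t2d) ∧
    ((a, b, c, d) = (true, true, true, true) →
      t = .t4a ∨ t = .t4b ∨ t = .t5a ∨ t = .t5b) := by
  rw [← h]
  clear h
  revert ht
  cases t <;> decide

namespace Mosaic

variable {N : ℕ} {M : Mosaic (N + 2)}

/-- At an edge arc, a strand can be pushed into the interior of the board. The two interior tiles
of the block become tiles of type IV. -/
theorem exists_isPush (hM : M.IsKnotMosaic) (h : (M.sideGrid hM).HasEdgeArc) :
    ∃ r c t', r + 1 < N + 2 ∧ c + 1 < N + 2 ∧ IsPush (blockAt M.tileAt r c) t' ∧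
      (∃ i j, 1 ≤ i ∧ i ≤ N ∧ 1 ≤ j ∧ j ≤ N ∧ (i = r ∨ i = r + 1) ∧ (j = c ∨ j = c + 1)) ∧
      ∀ i j, 1 ≤ i → i ≤ N → 1 ≤ j → j ≤ N → (i = r ∨ i = r + 1) → (j = c ∨ j = c + 1) →
        (M.tileAt i j = .t2a ∨ M.tileAt i j = .t2b ∨ M.tileAt i j = .t2c ∨
          M.tileAt i j = .t2d) ∧
        (blockUpdate M.tileAt r c t' i j = .t4a ∨ blockUpdate M.tileAt r c t' i j = .t4b) := by
  have key := fun i j => fun {a b c d : Bool} (h : (M.sideGrid hM).sides i j = (a, b, c, d)) =>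
    tile_eq_of_meets _ (M.tileAt_ne i j) ((sideGrid_sides hM i j).symm.trans h)
  rcases h with ⟨c, hc, hc', h1, h2, h3, h4⟩ | ⟨c, hc, hc', h1, h2, h3, h4⟩ |
      ⟨r, hr, hr', h1, h2, h3, h4⟩ | ⟨r, hr, hr', h1, h2, h3, h4⟩
  · have k1 := (key _ _ h1).1 rfl
    have k2 := (key _ _ h2).1 rfl
    have k3 := (key _ _ h3).2.2.2.2.2.1 rfl
    have k4 := (key _ _ h4).2.2.2.2.1 rfl
    refine ⟨0, c, (.t2d, .t2c, .t4b, .t4a), by omega, by omega, ?_,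
      ⟨1, c, by omega, by omega, by omega, by omega, by omega, by omega⟩, ?_⟩
    · simp only [blockAt, zero_add, k1, k2, k3, k4]
      exact .bottom
    · intro i j hi hi' hj hj' hir hjc
      obtain rfl : i = 1 := by omega
      rcases hjc with rfl | rfl <;> simp [blockUpdate, k3, k4]
  · have k1 := (key _ _ h1).2.2.1 rfl
    have k2 := (key _ _ h2).2.2.2.1 rfl
    have k3 := (key _ _ h3).1 rfl
    have k4 := (key _ _ h4).1 rfl
    refine ⟨N, c, (.t4a, .t4b, .t2a, .t2b), by omega, by omega, ?_,
      ⟨N, c, by omega, by omega, by omega, by omega, by omega, by omega⟩, ?_⟩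
    · simp only [blockAt, k1, k2, k3, k4]
      exact .top
    · intro i j hi hi' hj hj' hir hjc
      obtain rfl : i = N := by omega
      rcases hjc with rfl | rfl <;> simp [blockUpdate, k1, k2]
  · have k1 := (key _ _ h1).2.1 rfl
    have k2 := (key _ _ h2).2.2.2.1 rfl
    have k3 := (key _ _ h3).2.1 rfl
    have k4 := (key _ _ h4).2.2.2.2.1 rfl
    refine ⟨r, 0, (.t2b, .t4b, .t2c, .t4a), by omega, by omega, ?_,
      ⟨r, 1, by omega, by omega, by omega, by omega, by omega, by omega⟩, ?_⟩
    · simp only [blockAt, zero_add, k1, k2, k3, k4]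
      exact .left
    · intro i j hi hi' hj hj' hir hjc
      obtain rfl : j = 1 := by omega
      rcases hir with rfl | rfl <;> simp [blockUpdate, k2, k4]
  · have k1 := (key _ _ h1).2.2.1 rfl
    have k2 := (key _ _ h2).2.1 rfl
    have k3 := (key _ _ h3).2.2.2.2.2.1 rfl
    have k4 := (key _ _ h4).2.1 rfl
    refine ⟨r, N, (.t4a, .t2a, .t4b, .t2d), by omega, by omega, ?_,
      ⟨r, N, by omega, by omega, by omega, by omega, by omega, by omega⟩, ?_⟩
    · simp only [blockAt, k1, k2, k3, k4]
      exact .right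
    · intro i j hi hi' hj hj' hir hjc
      obtain rfl : j = N := by omega
      rcases hir with rfl | rfl <;> simp [blockUpdate, k1, k3]

end Mosaic

/-! ### Duals and the descent of the triple -/

theorem IsDualTile.eq_t1_iff {R T : Tile} (h : IsDualTile R T) :
    T = .t1 ↔ R = .t5a ∨ R = .t5b := by
  cases R <;> simp only [IsDualTile] at h <;> first
    | exact h.elim
    | (rcases h with rfl | rfl <;> decide)

theorem IsDualTile.eq_t1_or_t0_iff {R T : Tile} (h : IsDualTile R T) :
    (T = .t1 ∨ T = .t0) ↔ R = .t4a ∨ R = .t4b ∨ R = .t5a ∨ R = .t5b := by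
  cases R <;> simp only [IsDualTile] at h <;> first
    | exact h.elim
    | (rcases h with rfl | rfl <;> decide)

theorem exists_isDualTile {R : Tile} (h : R ≠ .t0) : ∃ T, IsDualTile R T := by
  cases R <;> simp_all [IsDualTile]

theorem exists_isDual {n : ℕ} (M : Mosaic n) : ∃ D, IsDual M D :=
  ⟨fun p => (exists_isDualTile (M.tile_ne p.1.1 p.1.2)).choose,
    fun p => (exists_isDualTile (M.tile_ne p.1.1 p.1.2)).choose_spec⟩

theorem card_nonCrossings_le {N : ℕ} {M : Mosaic (N + 2)} {D : Interior (N + 2) → Tile}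
    (hD : IsDual M D) : (Mosaic.nonCrossings N M.tileAt).card ≤ dualCard D := by
  have hsub : Mosaic.nonCrossings N M.tileAt ⊆
      (Finset.univ.filter fun p => D p ≠ .t1).image
        fun p : Interior (N + 2) => ((p.1.1 : ℕ), (p.1.2 : ℕ)) := by
    rintro ⟨i, j⟩ hp
    obtain ⟨⟨hi, hj⟩, h⟩ := Mosaic.mem_nonCrossings.1 hp
    simp only [Finset.mem_image, Finset.mem_filter, Finset.mem_univ, true_and]
    refine ⟨⟨(⟨i, by omega⟩, ⟨j, by omega⟩), by simp only; omega⟩, ?_, rfl⟩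
    rw [Ne, (hD _).eq_t1_iff, ← M.tileAt_val]
    exact not_or.2 h
  exact (Finset.card_le_card hsub).trans Finset.card_image_le

/-- On the interior part of the block `S`, tiles of type II become type IV, so their duals change
from type II to type 0. These still count in |D| but no longer in |D'|. -/
theorem dualCard_push {N : ℕ} {M M' : Mosaic (N + 2)} {D D' : Interior (N + 2) → Tile}
    (hD : IsDual M D) (hD' : IsDual M' D') (S : Set (ℕ × ℕ))
    (hS : ∃ i j, 1 ≤ i ∧ i ≤ N ∧ 1 ≤ j ∧ j ≤ N ∧ (i, j) ∈ S)
    (hout : ∀ i j, (i, j) ∉ S → M'.tileAt i j = M.tileAt i j)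
    (hin : ∀ i j, 1 ≤ i → i ≤ N → 1 ≤ j → j ≤ N → (i, j) ∈ S →
      (M.tileAt i j = .t2a ∨ M.tileAt i j = .t2b ∨ M.tileAt i j = .t2c ∨ M.tileAt i j = .t2d) ∧
      (M'.tileAt i j = .t4a ∨ M'.tileAt i j = .t4b)) :
    dualCard D' = dualCard D ∧ dualCard' D' < dualCard' D := by
  have key : ∀ p : Interior (N + 2), (((p.1.1 : ℕ), (p.1.2 : ℕ)) ∈ S ∧
        (D p ≠ .t1 ∧ D p ≠ .t0) ∧ D' p = .t0) ∨
      (((p.1.1 : ℕ), (p.1.2 : ℕ)) ∉ S ∧ (D' p = .t1 ↔ D p = .t1) ∧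
        (D' p = .t1 ∨ D' p = .t0 ↔ D p = .t1 ∨ D p = .t0)) := by
    intro p
    have d := hD p
    have d' := hD' p
    rw [← M.tileAt_val] at d
    rw [← M'.tileAt_val] at d'
    by_cases hp : ((p.1.1 : ℕ), (p.1.2 : ℕ)) ∈ S
    · left
      obtain ⟨h1, h2⟩ := hin _ _ (by have := p.2; omega) (by have := p.2; omega)
        (by have := p.2; omega) (by have := p.2; omega) hp
      refine ⟨hp, not_or.1 ?_, ?_⟩
      · rw [d.eq_t1_or_t0_iff]
        rcases h1 with h | h | h | h <;> rw [h] <;> decide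
      · rcases h2 with h | h <;> rw [h] at d' <;> exact d'
    · right
      rw [hout _ _ hp] at d'
      refine ⟨hp, ?_, ?_⟩
      · rw [d'.eq_t1_iff, d.eq_t1_iff]
      · rw [d'.eq_t1_or_t0_iff, d.eq_t1_or_t0_iff]
  constructor
  · unfold dualCard
    congr 1
    refine Finset.filter_congr fun p _ => ?_
    rcases key p with ⟨-, h1, h2⟩ | ⟨-, h1, -⟩
    · simp [h1, h2]
    · simp [h1]
  · unfold dualCard'
    obtain ⟨i, j, hi, hi', hj, hj', hij⟩ := hS
    refine Finset.card_lt_card ((Finset.ssubset_iff_of_subset fun p hp => ?_).2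
      ⟨⟨(⟨i, by omega⟩, ⟨j, by omega⟩), by simp only; omega⟩, ?_, ?_⟩)
    · simp only [Finset.mem_filter, Finset.mem_univ, true_and] at hp ⊢
      rcases key p with ⟨-, h1, h2⟩ | ⟨-, -, h1⟩
      · exact h1
      · tauto
    · simp only [Finset.mem_filter, Finset.mem_univ, true_and]
      rcases key ⟨(⟨i, by omega⟩, ⟨j, by omega⟩), by simp only; omega⟩ with ⟨-, h1, h2⟩ | ⟨h, -⟩
      · exact h1
      · exact absurd hij h
    · simp only [Finset.mem_filter, Finset.mem_univ, true_and]
      rcases key ⟨(⟨i, by omega⟩, ⟨j, by omega⟩), by simp only; omega⟩ with ⟨-, h1, h2⟩ | ⟨h, -⟩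
      · simp [h2]
      · exact absurd hij h

/-- In a dual with minimal triple and few tiles, every tile is blank or of type 0. -/
theorem HasMinimalTriple.eq_t1_or_t0 {N q : ℕ} (hN : N = 2 * q) {K : Set (Fin 3 → ℝ)}
    {M : Mosaic (N + 2)} {D : Interior (N + 2) → Tile} (h : HasMinimalTriple K M D)
    (hcard : dualCard D + 2 ≤ N) (p : Interior (N + 2)) : D p = .t1 ∨ D p = .t0 := by
  obtain ⟨hK, hD, hmin⟩ := h
  have hc : (M.sideGrid hK.1).D.card + 2 ≤ N :=
    (Nat.add_le_add_right (card_nonCrossings_le hD) 2).trans hcard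
  have hp := p.2
  rcases (M.sideGrid hK.1).sides_eq_or_hasEdgeArc hN hc (i := p.1.1) (j := p.1.2) (by omega)
    (by omega) (by omega) (by omega) with hs | harc
  · rw [(hD p).eq_t1_or_t0_iff, ← M.tileAt_val]
    exact (tile_eq_of_meets _ (M.tileAt_ne _ _)
      ((M.sideGrid_sides hK.1 _ _).symm.trans hs)).2.2.2.2.2.2 rfl
  · exfalso
    obtain ⟨r, c, t', hr, hc, hpush, ⟨i, j, hi, hi', hj, hj', hir, hjc⟩, hin⟩ :=
      M.exists_isPush hK.1 harc
    obtain ⟨M', hM', hknot, hmove⟩ := Mosaic.exists_push hK.1 hr hc hpush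
    obtain ⟨D', hD'⟩ := exists_isDual M'
    have hK' : M'.IsKnotMosaicFor K :=
      ⟨hknot, .trans _ _ _ (.symm _ _ (.rel _ _ hmove)) hK.2⟩
    obtain ⟨h1, h2⟩ := dualCard_push hD hD'
      {p | (p.1 = r ∨ p.1 = r + 1) ∧ (p.2 = c ∨ p.2 = c + 1)}
      ⟨i, j, hi, hi', hj, hj', hir, hjc⟩
      (fun i j hij => by rw [hM', blockUpdate_of_not hij])
      (fun i j hi hi' hj hj' hij => by rw [hM']; exact hin i j hi hi' hj hj' hij.1 hij.2)
    -- The first entries agree, so minimality compares the second entries, where the push gives a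
    -- strict decrease.
    have hle := hmin M' D' hK' hD'
    simp only [dualTriple, Prod.Lex.toLex_le_toLex, h1, lt_irrefl, false_or, true_and] at hle
    omega

theorem dualCard'_eq_zero {n : ℕ} {D : Interior n → Tile} (h : ∀ p, D p = .t1 ∨ D p = .t0) :
    dualCard' D = 0 := by
  simp only [dualCard', Finset.card_eq_zero, Finset.filter_eq_empty_iff]
  intro p _
  have := h p
  tauto

/-- A minimum exists by well-foundedness, and |D| is the leading entry of the triple, so it does not
grow. -/
theorem exists_hasMinimalTriple {n : ℕ} {K : Set (Fin 3 → ℝ)} {M : Mosaic n}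
    {D : Interior n → Tile} (hM : M.IsKnotMosaicFor K) (hD : IsDual M D) :
    ∃ (M₀ : Mosaic n) (D₀ : Interior n → Tile), HasMinimalTriple K M₀ D₀ ∧
      dualCard D₀ ≤ dualCard D := by
  let S : Set (ℕ ×ₗ (ℕ ×ₗ ℕ)) :=
    {x | ∃ (M : Mosaic n) (D : Interior n → Tile), M.IsKnotMosaicFor K ∧ IsDual M D ∧
      dualTriple D = x}
  have hS : S.Nonempty := ⟨_, M, D, hM, hD, rfl⟩
  obtain ⟨M₀, D₀, hM₀, hD₀, h₀⟩ := WellFounded.min_mem (wellFounded_lt (α := ℕ ×ₗ (ℕ ×ₗ ℕ))) S hS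
  have hmin : ∀ (M' : Mosaic n) (D' : Interior n → Tile), M'.IsKnotMosaicFor K → IsDual M' D' →
      dualTriple D₀ ≤ dualTriple D' := by
    intro M' D' hM' hD'
    rw [h₀]
    exact not_lt.1 (WellFounded.not_lt_min (wellFounded_lt (α := ℕ ×ₗ (ℕ ×ₗ ℕ))) S ⟨M', D', hM', hD', rfl⟩)
  refine ⟨M₀, D₀, ⟨hM₀, hD₀, hmin⟩, ?_⟩
  have := hmin M D hM hD
  simp only [dualTriple, Prod.Lex.toLex_le_toLex] at this
  omega

end KnotMosaic

/-- The hypothesis `|D| ≤ n - 4`, with `n = 2k`, is written additively. -/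
theorem corollary6p17 (k : ℕ) (K : Set (Fin 3 → ℝ)) :
    (∀ (M : KnotMosaic.Mosaic (2 * k)) (D : KnotMosaic.Interior (2 * k) → KnotMosaic.Tile),
      KnotMosaic.HasMinimalTriple K M D → KnotMosaic.dualCard D + 4 ≤ 2 * k →
        KnotMosaic.dualCard' D = 0 ∧
          ∀ p, D p = KnotMosaic.Tile.t1 ∨ D p = KnotMosaic.Tile.t0) ∧
    (∀ (M : KnotMosaic.Mosaic (2 * k)) (D : KnotMosaic.Interior (2 * k) → KnotMosaic.Tile),
      M.IsKnotMosaicFor K → KnotMosaic.IsDual M D → KnotMosaic.dualCard D + 4 ≤ 2 * k →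
        ∃ (M₀ : KnotMosaic.Mosaic (2 * k)) (D₀ : KnotMosaic.Interior (2 * k) → KnotMosaic.Tile),
          KnotMosaic.HasMinimalTriple K M₀ D₀ ∧ KnotMosaic.dualCard D₀ + 4 ≤ 2 * k ∧
            ∀ p, D₀ p = KnotMosaic.Tile.t1 ∨ D₀ p = KnotMosaic.Tile.t0) := by
  have key : ∀ (M : KnotMosaic.Mosaic (2 * k))
      (D : KnotMosaic.Interior (2 * k) → KnotMosaic.Tile),
      KnotMosaic.HasMinimalTriple K M D → KnotMosaic.dualCard D + 4 ≤ 2 * k →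
        ∀ p, D p = KnotMosaic.Tile.t1 ∨ D p = KnotMosaic.Tile.t0 := by
    -- For k = q + 1 the interior has side N = 2q, and |D| + 4 ≤ n becomes |D| + 2 ≤ N.
    rcases k with _ | q
    · intro M D _ h
      omega
    · intro M D hmin h
      exact hmin.eq_t1_or_t0 (N := 2 * q) rfl (by omega)
  refine ⟨fun M D hmin h => ⟨KnotMosaic.dualCard'_eq_zero (key M D hmin h), key M D hmin h⟩,
    fun M D hM hD h => ?_⟩
  obtain ⟨M₀, D₀, hmin, hle⟩ := KnotMosaic.exists_hasMinimalTriple hM hD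
  exact ⟨M₀, D₀, hmin, by omega, key M₀ D₀ hmin (by omega)⟩
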